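/- **The SZX-calculus.** Types are finite lists of registers $1_n$ ($n\ge 1$ qubits). Diagrams are built by sequential composition and parallel composition from: the empty diagram, wires $1_n\to 1_n$, swaps $1_n+1_m\to 1_m+1_n$, cups $0\to 1_n+1_n$ and caps $1_n+1_n\to 0$, Hadamard boxes $H_n:1_n\to 1_n$, green and red spiders with $k$ inputs and $l$ outputs of type $1_n$ and a vector of angles $\alpha\in\mathbb R^n$, dividers $1_{n+1}\to 1_1+1_n$, gatherers $1_1+1_n\to 1_{n+1}$, and matrix boxes $A:1_n\to 1_m$ for $A\in\mathbb F_2^{m\times n}$ (interpreted as $|x\rangle\mapsto|Ax\rangle$). Write $SZX\vdash D=D'$ if $D$ can be transformed into $D'$ by the rules of the calculus: only topology matters (strict symmetric monoidal laws, natural swaps, cups and caps, exchanging and bending spider legs); elimination and expansion for dividers and gatherers; distribution of the copy spider, of the one-legged spiders and of Hadamard through the divider; spider fusion, trivial spiders and colour change by Hadamard on wires of every size; copy, bialgebra, inverse scalars and the Euler rule on single qubits, in both colours; and for matrices $[0]=$ green erasure followed by red unit, $[1]=$ wire, $\begin{bmatrix}A\\B\end{bmatrix}=$ green copy followed by $A$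 and $B$ and gathering, $\begin{bmatrix}C&D\end{bmatrix}=$ dividing followed by $C$ and $D$ and a red merge (all with the scalars that make them sound). **Graph states.** For $\Gamma\in\mathbb F_2^{m\times n}$ let $|\Gamma\rangle:0\to 1_n+1_m$ be the diagram consisting of a green spider on $n$-qubit wires with one output $1_n$, whose other leg goes through the matrix box $\Gamma$, then $H_m$, into a green spider with output $1_m$, together with the scalar diagram of value $2^{-n/2}$. It represents the graph state of the bipartite graph with biadjacency matrix $\Gamma$; the outputs in $1_n$ are the column vertices and those in $1_m$ the row vertices. **Pivoting.** Let $G$ be a finite bipartite graph and $(u,v)$ an edge of $G$. The graph $G\wedge uv$ is obtained from $G$ by connecting $w\in N_u\setminus\{v\}$ and $t\in N_v\setminus\{u\}$ if and only if they are not connected in $G$, and exchanging the labels $u$ and $v$. **Lemma.** List the vertices of the two parts of $G$ so that $u$ is the first of the rows and $v$ is the first of the columns, and let $\Gamma_G\in\mathbb F_2^{m\times n}$ be the resulting biadjacency matrix. Let $\Gamma_{G\wedge uv}$ be the biadjacency matrix of $G\wedge uv$ for the same listing with $u$ and $v$ exchanged (so $v$ is the first row and $u$ is the first column). Then, for some $A\in\mathbb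 F_2^{1\times(n-1)}$, $B\in\mathbb F_2^{(m-1)\times 1}$, $C\in\mathbb F_2^{(m-1)\times(n-1)}$, $$\Gamma_G=\begin{bmatrix}1&A\\B&C\end{bmatrix},\qquad \Gamma_{G\wedge uv}=\begin{bmatrix}1&A\\B&C+BA\end{bmatrix},$$ and $$SZX\vdash\; H_{u,v}\,|\Gamma_G\rangle=|\Gamma_{G\wedge uv}\rangle,$$ where on both sides the outputs are divided and listed by vertex in the order $v$, $u$, remaining columns, remaining rows: on the left a Hadamard box is applied to each of the wires $u$ and $v$; on the right the first wires of the two registers, which belong to $u$ and $v$ in this order, are swapped. -/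

import Mathlib

namespace SZX

/-! ## Diagrams -/

/-- The two colours of spiders. -/
inductive Colour where
  | green
  | red

def Colour.other : Colour → Colour
  | .green => .red
  | .red => .green

/-- Diagrams of the scalable ZX-calculus with matrices, as terms over the generators. A register
wire `1_n` carries `n ≥ 1` qubits; a type is a formal sum of registers, that is, the list of their
sizes. These are raw terms: the positivity of the sizes and the matching of types in sequential
compositions are imposed by `Diag.WellTyped` below. -/
inductive Diag : Type where
  /-- The empty diagram `0 → 0`. -/
  | empty : Diag
  /-- The identity wire `1_n → 1_n`. -/
  | wire (n : ℕ) : Diag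
  /-- `1_n + 1_m → 1_m + 1_n`. -/
  | swap (n m : ℕ) : Diag
  /-- `0 → 1_n + 1_n`. -/
  | cup (n : ℕ) : Diag
  /-- `1_n + 1_n → 0`. -/
  | cap (n : ℕ) : Diag
  /-- The Hadamard box `1_n → 1_n`. -/
  | had (n : ℕ) : Diag
  /-- The spider with `k` inputs and `l` outputs of size `n`, and one angle per qubit. -/
  | spider (c : Colour) (n k l : ℕ) (α : Fin n → ℝ) : Diag
  /-- The divider `1_{n+1} → 1_1 + 1_n`. -/
  | div (n : ℕ) : Diag
  /-- The gatherer `1_1 + 1_n → 1_{n+1}`. -/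
  | gath (n : ℕ) : Diag
  /-- The matrix box `1_n → 1_m`, `|x⟩ ↦ |A x⟩`. -/
  | mat (m n : ℕ) (A : Matrix (Fin m) (Fin n) (ZMod 2)) : Diag
  /-- Sequential composition: first `f`, then `g`. -/
  | comp (f g : Diag) : Diag
  /-- Parallel composition. -/
  | tensor (f g : Diag) : Diag

infixl:65 " ⨟ " => Diag.comp
infixl:70 " ⊠ " => Diag.tensor

namespace Diag

/-- Input type. -/
def dom : Diag → List ℕ
  | empty => []
  | wire n => [n]
  | swap n m => [n, m]
  | cup _ => []
  | cap n => [n, n]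
  | had n => [n]
  | spider _ n k _ _ => List.replicate k n
  | div n => [n + 1]
  | gath n => [1, n]
  | mat _ n _ => [n]
  | comp f _ => f.dom
  | tensor f g => f.dom ++ g.dom

/-- Output type. -/
def cod : Diag → List ℕ
  | empty => []
  | wire n => [n]
  | swap n m => [m, n]
  | cup n => [n, n]
  | cap _ => []
  | had n => [n]
  | spider _ n _ l _ => List.replicate l n
  | div n => [1, n]
  | gath n => [n + 1]
  | mat m _ _ => [m]
  | comp _ g => g.cod
  | tensor f g => f.cod ++ g.cod

/-- The term is a diagram: all registers are non-empty, and sequential compositions are typed. -/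
def WellTyped : Diag → Prop
  | empty => True
  | wire n => 0 < n
  | swap n m => 0 < n ∧ 0 < m
  | cup n => 0 < n
  | cap n => 0 < n
  | had n => 0 < n
  | spider _ n _ _ _ => 0 < n
  | div n => 0 < n
  | gath n => 0 < n
  | mat m n _ => 0 < m ∧ 0 < n
  | comp f g => f.WellTyped ∧ g.WellTyped ∧ f.cod = g.dom
  | tensor f g => f.WellTyped ∧ g.WellTyped

/-! ## Derived diagrams -/

/-- The identity on a type. -/
def idn : List ℕ → Diag
  | [] => empty
  | n :: a => wire n ⊠ idn a

/-- The identity on a register of `n` qubits, which is no wire at all for `n = 0`. -/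
def reg : ℕ → Diag
  | 0 => empty
  | n + 1 => wire (n + 1)

/-- The divider of size `n`; the one of size `0` is the identity. -/
def divider : ℕ → Diag
  | 0 => wire 1
  | n + 1 => div (n + 1)

/-- The gatherer of size `n`; the one of size `0` is the identity. -/
def gatherer : ℕ → Diag
  | 0 => wire 1
  | n + 1 => gath (n + 1)

/-- The generalised divider `1_{a+b} → 1_a + 1_b`. -/
def gdiv : ℕ → ℕ → Diag
  | 0, b => reg b
  | a + 1, b => divider (a + b) ⨟ (wire 1 ⊠ gdiv a b) ⨟ (gatherer a ⊠ reg b)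

/-- The generalised gatherer `1_a + 1_b → 1_{a+b}`. -/
def ggath : ℕ → ℕ → Diag
  | 0, b => reg b
  | a + 1, b => (divider a ⊠ reg b) ⨟ (wire 1 ⊠ ggath a b) ⨟ gatherer (a + b)

/-- A wire of size `n` moved past the wires of the type `a`: `1_n + a → a + 1_n`. -/
def swapPast (n : ℕ) : List ℕ → Diag
  | [] => wire n
  | m :: a => (swap n m ⊠ idn a) ⨟ (wire m ⊠ swapPast n a)

/-- `k` Hadamard boxes of size `n` in parallel. -/
def hads (n : ℕ) : ℕ → Diag
  | 0 => empty
  | k + 1 => had n ⊠ hads n k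

/-- The spider with all angles `0`. -/
def spider₀ (c : Colour) (n k l : ℕ) : Diag := spider c n k l 0

/-- The scalar `√2 ^ n`: two spiders of different colours joined by one wire of size `n`. -/
def bone (c : Colour) (n : ℕ) : Diag := spider₀ c n 0 1 ⨟ spider₀ c.other n 1 0

/-- The scalar `(1 / √2) ^ n`: two spiders of different colours joined by three wires. -/
def tribone (c : Colour) (n : ℕ) : Diag := spider₀ c n 0 3 ⨟ spider₀ c.other n 3 0

/-- The scalar `exp (i γ)`. -/
noncomputable def phase (c : Colour) (γ : ℝ) : Diag :=
  tribone c 1 ⊠ (spider c.other 1 0 1 (fun _ => Real.pi) ⨟ spider c 1 1 0 (fun _ => γ))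

end Diag

open Diag

/-! ## Block matrices -/

/-- The block matrix with `A` above `B`. -/
def vstack {a b n : ℕ} (A : Matrix (Fin a) (Fin n) (ZMod 2)) (B : Matrix (Fin b) (Fin n) (ZMod 2)) :
    Matrix (Fin (a + b)) (Fin n) (ZMod 2) :=
  Matrix.of fun i j => Fin.addCases (fun i => A i j) (fun i => B i j) i

/-- The block matrix with `C` to the left of `D`. -/
def hstack {m c d : ℕ} (C : Matrix (Fin m) (Fin c) (ZMod 2)) (D : Matrix (Fin m) (Fin d) (ZMod 2)) :
    Matrix (Fin m) (Fin (c + d)) (ZMod 2) :=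
  Matrix.of fun i j => Fin.addCases (fun j => C i j) (fun j => D i j) j

/-! ## The angles in the Euler rule -/

noncomputable def eulerZ (α₁ α₂ : ℝ) : ℂ :=
  -(Real.sin ((α₁ + α₂) / 2) : ℂ) + Complex.I * (Real.cos ((α₁ + α₂) / 2 - α₂) : ℂ)

noncomputable def eulerZ' (α₁ α₂ : ℝ) : ℂ :=
  (Real.cos ((α₁ + α₂) / 2) : ℂ) - Complex.I * (Real.sin ((α₁ + α₂) / 2 - α₂) : ℂ)

noncomputable def eulerβ₁ (α₁ α₂ : ℝ) : ℝ :=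
  Complex.arg (eulerZ α₁ α₂) + Complex.arg (eulerZ' α₁ α₂)

open Classical in
noncomputable def eulerβ₂ (α₁ α₂ : ℝ) : ℝ :=
  if eulerZ' α₁ α₂ = 0 then 0
  else 2 * Complex.arg (Complex.I + (‖eulerZ α₁ α₂ / eulerZ' α₁ α₂‖ : ℂ))

noncomputable def eulerβ₃ (α₁ α₂ : ℝ) : ℝ :=
  Complex.arg (eulerZ α₁ α₂) - Complex.arg (eulerZ' α₁ α₂)

noncomputable def eulerγ (α₁ α₂ : ℝ) : ℝ :=
  (α₁ + α₂) / 2 - Complex.arg (eulerZ α₁ α₂) + (Real.pi - eulerβ₂ α₁ α₂) / 2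

/-! ## The calculus -/

/-- The rules of the calculus. They are used only for well-typed diagrams of equal types, see
`Provable`. Rules that mention a colour `c` hold in both colours. -/
inductive Rule : Diag → Diag → Prop
  -- Diagrams form a strict monoidal category.
  | comp_assoc (f g h) : Rule (f ⨟ g ⨟ h) (f ⨟ (g ⨟ h))
  | id_comp (f) : Rule (idn f.dom ⨟ f) f
  | comp_id (f) : Rule (f ⨟ idn f.cod) f
  | tensor_assoc (f g h) : Rule (f ⊠ g ⊠ h) (f ⊠ (g ⊠ h))
  | empty_tensor (f) : Rule (empty ⊠ f) f
  | tensor_empty (f) : Rule (f ⊠ empty) f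
  | interchange (f g h k) : Rule ((f ⊠ g) ⨟ (h ⊠ k)) ((f ⨟ h) ⊠ (g ⨟ k))
  -- Only topology matters: wires can be moved around, spider legs can be exchanged and bent.
  | swap_swap (n m) : Rule (swap n m ⨟ swap m n) (wire n ⊠ wire m)
  | swap_natural (n f) :
      Rule ((wire n ⊠ f) ⨟ swapPast n f.cod) (swapPast n f.dom ⨟ (f ⊠ wire n))
  | cup_swap (n) : Rule (cup n ⨟ swap n n) (cup n)
  | swap_cap (n) : Rule (swap n n ⨟ cap n) (cap n)
  | snake_left (n) : Rule ((cup n ⊠ wire n) ⨟ (wire n ⊠ cap n)) (wire n)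
  | snake_right (n) : Rule ((wire n ⊠ cup n) ⨟ (cap n ⊠ wire n)) (wire n)
  | spider_swap (c n k p q) (α : Fin n → ℝ) :
      Rule (spider c n k (p + 2 + q) α ⨟
          (idn (List.replicate p n) ⊠ swap n n ⊠ idn (List.replicate q n)))
        (spider c n k (p + 2 + q) α)
  | swap_spider (c n l p q) (α : Fin n → ℝ) :
      Rule ((idn (List.replicate p n) ⊠ swap n n ⊠ idn (List.replicate q n)) ⨟
          spider c n (p + 2 + q) l α)
        (spider c n (p + 2 + q) l α)
  | cup_spider (c n k l) (α : Fin n → ℝ) :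
      Rule ((cup n ⊠ idn (List.replicate k n)) ⨟ (wire n ⊠ spider c n (k + 1) l α))
        (spider c n k (l + 1) α)
  | spider_cap (c n k l) (α : Fin n → ℝ) :
      Rule ((wire n ⊠ spider c n k (l + 1) α) ⨟ (cap n ⊠ idn (List.replicate l n)))
        (spider c n (k + 1) l α)
  -- Elimination and expansion.
  | elim (n) : Rule (gath n ⨟ div n) (wire 1 ⊠ wire n)
  | expand (n) : Rule (div n ⨟ gath n) (wire (n + 1))
  -- Distribution through the divider of the ternary and of the unary spider, and of Hadamard.
  | copy_div (c n) :
      Rule (spider₀ c (n + 1) 1 2 ⨟ (div n ⊠ div n))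
        (div n ⨟ (spider₀ c 1 1 2 ⊠ spider₀ c n 1 2) ⨟ (wire 1 ⊠ swap 1 n ⊠ wire n))
  | unit_div (c n) (α : ℝ) (β : Fin n → ℝ) :
      Rule (spider c (n + 1) 0 1 (Fin.cons α β) ⨟ div n)
        (spider c 1 0 1 (fun _ => α) ⊠ spider c n 0 1 β)
  | had_div (n) : Rule (had (n + 1) ⨟ div n) (div n ⨟ (had 1 ⊠ had n))
  -- Spider fusion, along `j + 1` wires; trivial spiders; change of colour.
  | fusion (c n k₁ l₁ j k₂ l₂) (α β : Fin n → ℝ) :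
      Rule ((spider c n k₁ (l₁ + (j + 1)) α ⊠ idn (List.replicate k₂ n)) ⨟
          (idn (List.replicate l₁ n) ⊠ spider c n ((j + 1) + k₂) l₂ β))
        (spider c n (k₁ + k₂) (l₁ + l₂) (α + β))
  | spider_wire (c n) : Rule (spider₀ c n 1 1) (wire n)
  | had_spider (c n k l) (α : Fin n → ℝ) :
      Rule (hads n k ⨟ spider c n k l α ⨟ hads n l) (spider c.other n k l α)
  -- Copy, bialgebra, inverse scalars and Euler decomposition, on single qubits.
  | copy (c : Colour) :
      Rule (bone c 1 ⊠ (spider₀ c.other 1 0 1 ⨟ spider₀ c 1 1 2))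
        (spider₀ c.other 1 0 1 ⊠ spider₀ c.other 1 0 1)
  | bialgebra (c : Colour) :
      Rule (spider₀ c.other 1 2 1 ⨟ spider₀ c 1 1 2)
        (bone c 1 ⊠ ((spider₀ c 1 1 2 ⊠ spider₀ c 1 1 2) ⨟ (wire 1 ⊠ swap 1 1 ⊠ wire 1) ⨟
          (spider₀ c.other 1 2 1 ⊠ spider₀ c.other 1 2 1)))
  | scalar (c) : Rule (bone c 1 ⊠ tribone c 1) empty
  | euler (c) (α₁ α₂ : ℝ) :
      Rule (spider c 1 1 1 (fun _ => α₁) ⨟ had 1 ⨟ spider c 1 1 1 (fun _ => α₂))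
        (phase c (eulerγ α₁ α₂) ⊠
          (spider c.other 1 1 1 (fun _ => eulerβ₁ α₁ α₂) ⨟
            spider c 1 1 1 (fun _ => eulerβ₂ α₁ α₂) ⨟
            spider c.other 1 1 1 (fun _ => eulerβ₃ α₁ α₂)))
  -- Matrices.
  | mat_zero :
      Rule (mat 1 1 0) (tribone .green 1 ⊠ (spider₀ .green 1 1 0 ⨟ spider₀ .red 1 0 1))
  | mat_one : Rule (mat 1 1 1) (wire 1)
  | mat_rows (a b n) (A : Matrix (Fin a) (Fin n) (ZMod 2)) (B : Matrix (Fin b) (Fin n) (ZMod 2)) :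
      Rule (mat (a + b) n (vstack A B))
        (spider₀ .green n 1 2 ⨟ (mat a n A ⊠ mat b n B) ⨟ ggath a b)
  | mat_cols (m c d) (C : Matrix (Fin m) (Fin c) (ZMod 2)) (D : Matrix (Fin m) (Fin d) (ZMod 2)) :
      Rule (mat m (c + d) (hstack C D))
        (bone .green m ⊠ (gdiv c d ⨟ (mat m c C ⊠ mat m d D) ⨟ spider₀ .red m 2 1))

/-- `SZX ⊢ D = D'`: the diagram `D` can be transformed into `D'` by applying rules of the calculus,
in either direction, to subdiagrams. -/
inductive Provable : Diag → Diag → Prop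
  | rule {D D' : Diag} : Rule D D' → D.WellTyped → D'.WellTyped → D.dom = D'.dom → D.cod = D'.cod →
      Provable D D'
  | refl {D : Diag} : D.WellTyped → Provable D D
  | symm {D D' : Diag} : Provable D D' → Provable D' D
  | trans {D D' D'' : Diag} : Provable D D' → Provable D' D'' → Provable D D''
  | comp {f f' g g' : Diag} : Provable f f' → Provable g g' → f.cod = g.dom →
      Provable (f ⨟ g) (f' ⨟ g')
  | tensor {f f' g g' : Diag} : Provable f f' → Provable g g' → Provable (f ⊠ g) (f' ⊠ g')

/-! ## Bipartite graph states and pivoting -/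

/-- The bipartite graph-state diagram `0 → 1_n + 1_m` with biadjacency matrix `Γ`: a green spider
for the `n` vertices indexing the columns and one for the `m` vertices indexing the rows, each with
an output, joined through `Γ` and Hadamard; with the scalar `(1 / √2) ^ n`. Its interpretation is
the normalised graph state. -/
def bipartiteGraphState (m n : ℕ) (Γ : Matrix (Fin m) (Fin n) (ZMod 2)) : Diag :=
  tribone .green n ⊠
    (spider₀ .green n 0 2 ⨟ (wire n ⊠ (mat m n Γ ⨟ had m ⨟ spider₀ .green m 1 1)))

/-- A register of `p` qubits exchanged with a single qubit: `1_p + 1_1 → 1_1 + 1_p`. -/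
def restSwap : ℕ → Diag
  | 0 => wire 1
  | p + 1 => swap (p + 1) 1

/-- `1_{1+p} + 1_{1+q} → 1_1 + 1_1 + 1_p + 1_q`: the first qubits of two registers are extracted. -/
def firstQubits (p q : ℕ) : Diag :=
  (divider p ⊠ divider q) ⨟
    (wire 1 ⊠ restSwap p ⊠ reg q)

open Classical in
/-- The biadjacency matrix of a graph whose vertices are listed by `e` as rows, then columns. -/
noncomputable def biadjacency {V : Type*} {m n : ℕ} (G : SimpleGraph V) (e : Fin m ⊕ Fin n ≃ V) :
    Matrix (Fin m) (Fin n) (ZMod 2) :=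
  Matrix.of fun i j => if G.Adj (e (Sum.inl i)) (e (Sum.inr j)) then 1 else 0

/-- Pivoting `G ∧ uv`: the labels `u` and `v` are exchanged, and `a, b ∉ {u, v}` with one in the
neighbourhood of `u` and the other in that of `v` (but not both in both) are connected iff they were
not. In a bipartite graph with an edge `uv` the neighbourhoods are disjoint. -/
def pivot {V : Type*} [DecidableEq V] (G : SimpleGraph V) (u v : V) : SimpleGraph V where
  Adj a b :=
    Xor (G.Adj (Equiv.swap u v a) (Equiv.swap u v b))
      (a ≠ u ∧ a ≠ v ∧ b ≠ u ∧ b ≠ v ∧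
        Xor (G.Adj u a ∧ G.Adj v b) (G.Adj v a ∧ G.Adj u b))
  symm := ⟨fun a b h => by
    rw [G.adj_comm (Equiv.swap u v b)]
    unfold Xor at *
    tauto⟩
  loopless := ⟨fun a h => by
    unfold Xor at h
    have := G.loopless.irrefl (Equiv.swap u v a)
    tauto⟩

end SZX

/-!
Why pivoting is derivable. Write `y` for the first column bit (the vertex `v`), `x` for the other
column bits, and `A`, `B`, `C` for the blocks of the biadjacency matrix. The graph state is the
uniform superposition over `(y, x)` of the columns `(y, x)` together with the rows
`(y + A x, B y + C x)`, the rows being followed by Hadamard boxes. Two Hadamard boxes on `u` cancel,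
so both sides of the claim are a uniform superposition followed by a linear map followed by
Hadamard boxes on `v` and on the rows other than `u`. The linear part is
`(y, x) ↦ (y, y + A x, x, B y + C x)` on the left; on the right, where `y` now belongs to `u`, it is,
after the swap, `(y, x) ↦ (y + A x, y, x, B y + (C + B A) x)`. The shear `(y, x) ↦ (y + A x, x)` of
the variables carries the first to the second, as `A x + A x = 0`, and it preserves the uniform superposition.

To make this an argument inside the calculus, well-typed diagrams modulo provable equality are
organised as a symmetric monoidal category `Ty`; ill-typed diagrams are collected in one additional
class, so that composition is total. Green spiders make every register a cocommutative comonoid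
(copying and erasing bit strings), and red spiders, rescaled, make a single qubit a commutative
monoid (addition of bits) whose operations are comonoid homomorphisms, by the copy and bialgebra
rules. With the Hopf law (`hopf_law`) the comonoid homomorphisms from a cocommutative comonoid to a
single qubit form a vector space over `ZMod 2`, called `Lin`. Comonoid homomorphisms can be paired and
projected as in a cartesian category, and one into a register is determined by its coordinates
(`eq_of_comp_coord`). The matrix rules say that a matrix box is a comonoid homomorphism that acts on
coordinates as the matrix (`matBox_comp_coord`), which turns identities between diagrams of boxes
into linear algebra.

Invariance of the uniform superposition under the shear (`unif_comp_shear`) comes down to the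
identity `green_unit_add`: a uniform bit to which another bit is added is uniform and independent
of that bit. `graphState_eq` puts a graph state into the form above, `graphState_pivot` compares the
two sides, and `biadjacency_pivot` computes the biadjacency matrix of the pivoted graph.
-/

namespace SZX

open CategoryTheory MonoidalCategory Diag

/-! ### Diagrams modulo the calculus -/

namespace Diag

theorem WellTyped.dom_pos {f : Diag} (h : f.WellTyped) : ∀ n ∈ f.dom, 0 < n := by
  induction f <;> simp_all [WellTyped, dom, or_imp]

theorem WellTyped.cod_pos {f : Diag} (h : f.WellTyped) : ∀ n ∈ f.cod, 0 < n := by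
  induction f <;> simp_all [WellTyped, cod, or_imp]

@[simp] theorem dom_idn (a : List ℕ) : (idn a).dom = a := by
  induction a <;> simp_all [idn, dom]

@[simp] theorem cod_idn (a : List ℕ) : (idn a).cod = a := by
  induction a <;> simp_all [idn, cod]

theorem wellTyped_idn {a : List ℕ} (h : ∀ n ∈ a, 0 < n) : (idn a).WellTyped := by
  induction a <;> simp_all [idn, WellTyped]

@[simp] theorem dom_swapPast (n : ℕ) (a : List ℕ) : (swapPast n a).dom = n :: a := by
  induction a <;> simp_all [swapPast, dom]

@[simp] theorem cod_swapPast (n : ℕ) (a : List ℕ) : (swapPast n a).cod = a ++ [n] := by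
  induction a <;> simp_all [swapPast, cod]

theorem wellTyped_swapPast {n : ℕ} {a : List ℕ} (hn : 0 < n) (h : ∀ n ∈ a, 0 < n) :
    (swapPast n a).WellTyped := by
  induction a <;> simp_all [swapPast, WellTyped, dom, cod, wellTyped_idn]

end Diag

theorem Provable.wellTyped {f g : Diag} (h : Provable f g) :
    f.WellTyped ∧ g.WellTyped ∧ f.dom = g.dom ∧ f.cod = g.cod := by
  induction h <;> simp_all [Diag.WellTyped, Diag.dom, Diag.cod]

/-- Provable equality of diagrams, with all ill-typed terms identified. This makes both
compositions total congruences. -/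
def diagSetoid : Setoid Diag where
  r f g := Provable f g ∨ (¬ f.WellTyped ∧ ¬ g.WellTyped)
  iseqv :=
    { refl := fun f => by
        by_cases h : f.WellTyped
        · exact Or.inl (.refl h)
        · exact Or.inr ⟨h, h⟩
      symm := fun h => h.imp Provable.symm And.symm
      trans := by
        rintro f g k (h | h) (h' | h')
        · exact Or.inl (h.trans h')
        · exact absurd h.wellTyped.2.1 h'.1
        · exact absurd h'.wellTyped.1 h.2
        · exact Or.inr ⟨h.1, h'.2⟩ }

/-- Diagrams modulo provable equality; the ill-typed terms form one additional class. -/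
def DClass : Type := Quotient diagSetoid

/-- The class of a diagram. -/
def cls (f : Diag) : DClass := Quotient.mk diagSetoid f

theorem cls_eq {f g : Diag} (h : Provable f g) : cls f = cls g :=
  Quotient.sound (s := diagSetoid) (Or.inl h)

theorem cls_eq_of_not {f g : Diag} (hf : ¬ f.WellTyped) (hg : ¬ g.WellTyped) : cls f = cls g :=
  Quotient.sound (s := diagSetoid) (Or.inr ⟨hf, hg⟩)

theorem provable_of_cls_eq {f g : Diag} (hf : f.WellTyped) (h : cls f = cls g) : Provable f g :=
  (Quotient.exact (s := diagSetoid) h).resolve_right fun h => h.1 hf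

/-- A rule whose two sides are well-typed of the same type holds for classes. -/
theorem cls_rule {f g : Diag} (r : Rule f g)
    (h : f.WellTyped ∧ g.WellTyped ∧ f.dom = g.dom ∧ f.cod = g.cod) : cls f = cls g :=
  cls_eq (.rule r h.1 h.2.1 h.2.2.1 h.2.2.2)

namespace DClass

/-- Sequential composition of classes of diagrams. -/
def comp : DClass → DClass → DClass :=
  Quotient.map₂ Diag.comp (by
    rintro f f' (hf | hf) g g' (hg | hg)
    · have h1 := hf.wellTyped
      have h2 := hg.wellTyped
      by_cases h : f.cod = g.dom
      · exact Or.inl (hf.comp hg h)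
      · refine Or.inr ⟨fun h' => h h'.2.2, fun h' => h ?_⟩
        rw [h1.2.2.2, h2.2.2.1, h'.2.2]
    · exact Or.inr ⟨fun h => hg.1 h.2.1, fun h => hg.2 h.2.1⟩
    · exact Or.inr ⟨fun h => hf.1 h.1, fun h => hf.2 h.1⟩
    · exact Or.inr ⟨fun h => hf.1 h.1, fun h => hf.2 h.1⟩)

/-- Parallel composition of classes of diagrams. -/
def tensor : DClass → DClass → DClass :=
  Quotient.map₂ Diag.tensor (by
    rintro f f' (hf | hf) g g' (hg | hg)
    · exact Or.inl (hf.tensor hg)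
    · exact Or.inr ⟨fun h => hg.1 h.2, fun h => hg.2 h.2⟩
    · exact Or.inr ⟨fun h => hf.1 h.1, fun h => hf.2 h.1⟩
    · exact Or.inr ⟨fun h => hf.1 h.1, fun h => hf.2 h.1⟩)

end DClass

/-- Parallel composition is a monoid structure on classes, written multiplicatively. -/
instance : Monoid DClass where
  mul := DClass.tensor
  one := cls .empty
  mul_assoc := by
    rintro ⟨f⟩ ⟨g⟩ ⟨h⟩
    by_cases H : f.WellTyped ∧ g.WellTyped ∧ h.WellTyped
    · exact cls_rule (.tensor_assoc f g h)
        ⟨⟨⟨H.1, H.2.1⟩, H.2.2⟩, ⟨H.1, H.2.1, H.2.2⟩, by simp [Diag.dom], by simp [Diag.cod]⟩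
    · exact cls_eq_of_not (fun h => H ⟨h.1.1, h.1.2, h.2⟩) (fun h => H ⟨h.1, h.2.1, h.2.2⟩)
  one_mul := by
    rintro ⟨f⟩
    by_cases H : f.WellTyped
    · exact cls_rule (.empty_tensor f) ⟨⟨trivial, H⟩, H, by simp [Diag.dom], by simp [Diag.cod]⟩
    · exact cls_eq_of_not (fun h => H h.2) H
  mul_one := by
    rintro ⟨f⟩
    by_cases H : f.WellTyped
    · exact cls_rule (.tensor_empty f) ⟨⟨H, trivial⟩, H, by simp [Diag.dom], by simp [Diag.cod]⟩
    · exact cls_eq_of_not (fun h => H h.1) H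

/-- Sequential composition of classes, in diagrammatic order. -/
infixl:65 " ⊚ " => DClass.comp

theorem cls_comp (f g : Diag) : cls (f ⨟ g) = cls f ⊚ cls g := rfl

theorem DClass.comp_assoc (f g h : DClass) : f ⊚ g ⊚ h = f ⊚ (g ⊚ h) := by
  rcases f with ⟨f⟩
  rcases g with ⟨g⟩
  rcases h with ⟨h⟩
  by_cases H : (f ⨟ g ⨟ h).WellTyped
  · exact cls_rule (.comp_assoc f g h)
      ⟨H, ⟨H.1.1, ⟨H.1.2.1, H.2.1, H.2.2⟩, H.1.2.2⟩, rfl, rfl⟩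
  · exact cls_eq_of_not H fun h' => H ⟨⟨h'.1, h'.2.1.1, h'.2.2⟩, h'.2.1.2.1, h'.2.1.2.2⟩

/-- The class `s` consists of well-typed diagrams of type `a → b`. -/
def IsHom (s : DClass) (a b : List ℕ) : Prop :=
  ∃ f : Diag, f.WellTyped ∧ f.dom = a ∧ f.cod = b ∧ cls f = s

/-- The class of the identity on a type. -/
def one (a : List ℕ) : DClass := cls (idn a)

namespace IsHom

variable {s t s' t' : DClass} {a b c a' b' c' : List ℕ}

theorem of_cls {f : Diag} (h : f.WellTyped) : IsHom (cls f) f.dom f.cod := ⟨f, h, rfl, rfl, rfl⟩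

theorem comp (h : IsHom s a b) (h' : IsHom t b c) : IsHom (s ⊚ t) a c := by
  obtain ⟨f, hf, rfl, rfl, rfl⟩ := h
  obtain ⟨g, hg, hd, rfl, rfl⟩ := h'
  exact ⟨f ⨟ g, ⟨hf, hg, hd.symm⟩, rfl, rfl, rfl⟩

theorem mul (h : IsHom s a b) (h' : IsHom t a' b') : IsHom (s * t) (a ++ a') (b ++ b') := by
  obtain ⟨f, hf, rfl, rfl, rfl⟩ := h
  obtain ⟨g, hg, rfl, rfl, rfl⟩ := h'
  exact ⟨f ⊠ g, ⟨hf, hg⟩, rfl, rfl, rfl⟩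

theorem one {a : List ℕ} (h : ∀ n ∈ a, 0 < n) : IsHom (one a) a a :=
  ⟨idn a, wellTyped_idn h, by simp, by simp, rfl⟩

theorem dom_pos (h : IsHom s a b) : ∀ n ∈ a, 0 < n := by
  obtain ⟨f, hf, rfl, rfl, rfl⟩ := h
  exact hf.dom_pos

theorem cod_pos (h : IsHom s a b) : ∀ n ∈ b, 0 < n := by
  obtain ⟨f, hf, rfl, rfl, rfl⟩ := h
  exact hf.cod_pos

theorem one_comp (h : IsHom s a b) : SZX.one a ⊚ s = s := by
  obtain ⟨f, hf, rfl, rfl, rfl⟩ := h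
  exact cls_rule (.id_comp f)
    ⟨⟨wellTyped_idn hf.dom_pos, hf, by simp⟩, hf, by simp [Diag.dom], rfl⟩

theorem comp_one (h : IsHom s a b) : s ⊚ SZX.one b = s := by
  obtain ⟨f, hf, rfl, rfl, rfl⟩ := h
  exact cls_rule (.comp_id f)
    ⟨⟨hf, wellTyped_idn hf.cod_pos, by simp⟩, hf, rfl, by simp [Diag.cod]⟩

theorem interchange (h1 : IsHom s a b) (h2 : IsHom s' b c) (h3 : IsHom t a' b')
    (h4 : IsHom t' b' c') : (s * t) ⊚ (s' * t') = (s ⊚ s') * (t ⊚ t') := by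
  obtain ⟨f, hf, rfl, rfl, rfl⟩ := h1
  obtain ⟨f', hf', hfd, rfl, rfl⟩ := h2
  obtain ⟨g, hg, rfl, rfl, rfl⟩ := h3
  obtain ⟨g', hg', hgd, rfl, rfl⟩ := h4
  exact cls_rule (.interchange f g f' g')
    ⟨⟨⟨hf, hg⟩, ⟨hf', hg'⟩, by simp [Diag.dom, Diag.cod, hfd, hgd]⟩,
      ⟨⟨hf, hf', hfd.symm⟩, ⟨hg, hg', hgd.symm⟩⟩, rfl, rfl⟩

end IsHom

theorem one_nil : one [] = 1 := rfl

theorem one_append (a b : List ℕ) : one (a ++ b) = one a * one b := by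
  induction a with
  | nil => simp [one_nil]
  | cons n a ih =>
    change cls (wire n) * one (a ++ b) = cls (wire n) * one a * one b
    rw [ih, mul_assoc]

theorem one_cons (n : ℕ) (a : List ℕ) : one (n :: a) = one [n] * one a := one_append [n] a

theorem cls_wire (n : ℕ) : cls (wire n) = one [n] := (mul_one (cls (wire n))).symm

/-! ### The symmetric monoidal category of diagrams -/

/-- A type of the calculus: a list of registers of positive sizes. -/
structure Ty where
  /-- The sizes of the registers. -/
  regs : List ℕ
  pos : ∀ n ∈ regs, 0 < n

/-- The morphisms between two types: diagrams modulo provable equality. -/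
@[ext]
structure Mor (X Y : Ty) where
  /-- The underlying class. -/
  val : DClass
  isHom : IsHom val X.regs Y.regs

instance : Category Ty where
  Hom := Mor
  id X := ⟨one X.regs, .one X.pos⟩
  comp f g := ⟨f.val ⊚ g.val, f.isHom.comp g.isHom⟩
  id_comp f := Mor.ext f.isHom.one_comp
  comp_id f := Mor.ext f.isHom.comp_one
  assoc _ _ _ := Mor.ext (DClass.comp_assoc _ _ _)

theorem hom_ext {X Y : Ty} {f g : X ⟶ Y} (h : f.val = g.val) : f = g := Mor.ext h

@[simp] theorem val_id (X : Ty) : Mor.val (𝟙 X) = one X.regs := rfl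
@[simp] theorem val_comp {X Y Z : Ty} (f : X ⟶ Y) (g : Y ⟶ Z) :
    Mor.val (f ≫ g) = f.val ⊚ g.val := rfl

/-- The identity diagram as an isomorphism between two types that are equal as lists. The monoidal
structure is strict at the level of diagrams, and all coherence isomorphisms are of this form. -/
def idIso {X Y : Ty} (h : X.regs = Y.regs) : X ≅ Y where
  hom := ⟨one X.regs, by have := IsHom.one X.pos; rwa [← h]⟩
  inv := ⟨one X.regs, by have := IsHom.one X.pos; rwa [← h]⟩
  hom_inv_id := hom_ext (IsHom.one X.pos).comp_one
  inv_hom_id := hom_ext (by simp [h, (IsHom.one Y.pos).comp_one])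

instance : MonoidalCategoryStruct Ty where
  tensorObj X Y := ⟨X.regs ++ Y.regs, by
    simpa [or_imp, forall_and] using And.intro X.pos Y.pos⟩
  tensorUnit := ⟨[], by simp⟩
  tensorHom f g := ⟨f.val * g.val, f.isHom.mul g.isHom⟩
  whiskerLeft X _ _ f := ⟨one X.regs * f.val, (IsHom.one X.pos).mul f.isHom⟩
  whiskerRight f Y := ⟨f.val * one Y.regs, f.isHom.mul (.one Y.pos)⟩
  associator X Y Z := idIso (List.append_assoc _ _ _)
  leftUnitor X := idIso (List.nil_append _)
  rightUnitor X := idIso (List.append_nil _)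

@[simp] theorem regs_tensor (X Y : Ty) : (X ⊗ Y).regs = X.regs ++ Y.regs := rfl
@[simp] theorem regs_unit : (𝟙_ Ty).regs = [] := rfl

section

variable {X Y Z W : Ty}

@[simp] theorem val_tensorHom (f : X ⟶ Y) (g : Z ⟶ W) :
    Mor.val (f ⊗ₘ g) = f.val * g.val := rfl
@[simp] theorem val_whiskerLeft (f : X ⟶ Y) : Mor.val (Z ◁ f) = one Z.regs * f.val := rfl
@[simp] theorem val_whiskerRight (f : X ⟶ Y) : Mor.val (f ▷ Z) = f.val * one Z.regs := rfl
@[simp] theorem val_associator_hom :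
    Mor.val (α_ X Y Z).hom = one ((X.regs ++ Y.regs) ++ Z.regs) := rfl
@[simp] theorem val_associator_inv :
    Mor.val (α_ X Y Z).inv = one ((X.regs ++ Y.regs) ++ Z.regs) := rfl
@[simp] theorem val_leftUnitor_hom : Mor.val (λ_ X).hom = one X.regs := rfl
@[simp] theorem val_leftUnitor_inv : Mor.val (λ_ X).inv = one X.regs := rfl
@[simp] theorem val_rightUnitor_hom : Mor.val (ρ_ X).hom = one X.regs := by
  change one (X.regs ++ []) = _
  simp
@[simp] theorem val_rightUnitor_inv : Mor.val (ρ_ X).inv = one X.regs := by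
  change one (X.regs ++ []) = _
  simp

end

theorem Ty.one_comp_one (X : Ty) : one X.regs ⊚ one X.regs = one X.regs :=
  (IsHom.one X.pos).one_comp

instance : MonoidalCategory Ty := .ofTensorHom
  (id_tensorHom_id := fun X Y => hom_ext (by simp [one_append]))
  (id_tensorHom := fun X _ _ f => rfl)
  (tensorHom_id := fun f X => rfl)
  (tensorHom_comp_tensorHom := fun f₁ f₂ g₁ g₂ => hom_ext
    (f₁.isHom.interchange g₁.isHom f₂.isHom g₂.isHom))
  (associator_naturality := fun {X₁ X₂ X₃ Y₁ Y₂ Y₃} f₁ f₂ f₃ => hom_ext (by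
    have h := (f₁ ⊗ₘ f₂ ⊗ₘ f₃).isHom.one_comp
    have h' := ((f₁ ⊗ₘ f₂) ⊗ₘ f₃).isHom.comp_one
    simp only [regs_tensor, val_tensorHom] at h h'
    simp only [val_comp, val_tensorHom, val_associator_hom, List.append_assoc] at *
    rw [h, h', mul_assoc]))
  (leftUnitor_naturality := fun f => hom_ext (by
    simp [one_nil, f.isHom.comp_one, f.isHom.one_comp]))
  (rightUnitor_naturality := fun f => hom_ext (by
    simp [one_nil, f.isHom.comp_one, f.isHom.one_comp]))
  (pentagon := fun W X Y Z => hom_ext (by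
    have h := (((W ⊗ X) ⊗ Y) ⊗ Z).one_comp_one
    simp only [regs_tensor] at h
    simp only [val_comp, val_tensorHom, val_id, val_associator_hom, regs_tensor,
      ← one_append, List.append_assoc] at *
    rw [h, h]))
  (triangle := fun X Y => hom_ext (by
    have h := (X ⊗ Y).one_comp_one
    simp only [regs_tensor] at h
    simp [← one_append, h]))

namespace IsHom

variable {s t f g : DClass} {a b c d a' b' c' d' : List ℕ}

theorem one_mul_comp (ha : ∀ n ∈ a, 0 < n) (hf : IsHom f b c) (hg : IsHom g c d) :
    SZX.one a * (f ⊚ g) = (SZX.one a * f) ⊚ (SZX.one a * g) := by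
  rw [(IsHom.one ha).interchange (IsHom.one ha) hf hg, (IsHom.one ha).comp_one]

theorem comp_mul_one (ha : ∀ n ∈ a, 0 < n) (hf : IsHom f b c) (hg : IsHom g c d) :
    (f ⊚ g) * SZX.one a = (f * SZX.one a) ⊚ (g * SZX.one a) := by
  rw [hf.interchange hg (IsHom.one ha) (IsHom.one ha), (IsHom.one ha).comp_one]

theorem mul_one_comp_one_mul (hf : IsHom f a b) (hg : IsHom g c d) :
    (f * SZX.one c) ⊚ (SZX.one b * g) = f * g := by
  rw [hf.interchange (.one hf.cod_pos) (.one hg.dom_pos) hg, hf.comp_one, hg.one_comp]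

theorem one_mul_comp_mul_one (hf : IsHom f a b) (hg : IsHom g c d) :
    (SZX.one a * g) ⊚ (f * SZX.one d) = f * g := by
  rw [(IsHom.one hf.dom_pos).interchange hf hg (.one hg.cod_pos), hf.one_comp, hg.comp_one]

end IsHom

/-! ### The braiding -/

/-- A wire moved past a type, as a class. -/
def past (n : ℕ) (a : List ℕ) : DClass := cls (swapPast n a)

/-- The exchange of two types, `a + b → b + a`. -/
def braid : List ℕ → List ℕ → DClass
  | [], b => one b
  | n :: a, b => (one [n] * braid a b) ⊚ (past n b * one a)

section

variable {n m : ℕ} {a a' b b' : List ℕ} {f : DClass}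

theorem pos_append (ha : ∀ n ∈ a, 0 < n) (hb : ∀ n ∈ b, 0 < n) : ∀ n ∈ a ++ b, 0 < n := by
  simpa [or_imp, forall_and] using And.intro ha hb

theorem pos_singleton (hn : 0 < n) : ∀ k ∈ [n], 0 < k := by simpa

theorem isHom_past (hn : 0 < n) (ha : ∀ n ∈ a, 0 < n) : IsHom (past n a) (n :: a) (a ++ [n]) :=
  ⟨_, wellTyped_swapPast hn ha, by simp, by simp, rfl⟩

theorem isHom_swap (hn : 0 < n) (hm : 0 < m) : IsHom (cls (swap n m)) [n, m] [m, n] :=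
  .of_cls (f := swap n m) ⟨hn, hm⟩

theorem past_nil : past n [] = one [n] := cls_wire n

theorem past_cons : past n (m :: a) = (cls (swap n m) * one a) ⊚ (one [m] * past n a) := by
  rw [← cls_wire]
  rfl

theorem past_append (hn : 0 < n) (ha : ∀ n ∈ a, 0 < n) (hb : ∀ n ∈ b, 0 < n) :
    past n (a ++ b) = (past n a * one b) ⊚ (one a * past n b) := by
  induction a with
  | nil =>
    rw [past_nil, ← one_append, one_nil, one_mul]
    exact (isHom_past hn hb).one_comp.symm
  | cons m a ih =>
    simp only [List.mem_cons, forall_eq_or_imp] at ha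
    have hm := pos_singleton ha.1
    have h1 := ((isHom_past hn ha.2).mul (.one hb))
    have h2 : IsHom (one [m] * past n a) ([m, n] ++ a) ([m] ++ (a ++ [n])) :=
      (IsHom.one hm).mul (isHom_past hn ha.2)
    rw [List.cons_append, past_cons, ih ha.2, past_cons,
      IsHom.one_mul_comp hm h1 (by simpa using (IsHom.one ha.2).mul (isHom_past hn hb)),
      one_append, one_cons m a,
      IsHom.comp_mul_one hb ((isHom_swap hn ha.1).mul (.one ha.2)) h2]
    simp only [mul_assoc, DClass.comp_assoc]

theorem past_natural (hn : 0 < n) (hf : IsHom f a b) :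
    (one [n] * f) ⊚ past n b = past n a ⊚ (f * one [n]) := by
  obtain ⟨f, hf, rfl, rfl, rfl⟩ := hf
  rw [← cls_wire]
  refine cls_rule (.swap_natural n f) ⟨⟨⟨hn, hf⟩, wellTyped_swapPast hn hf.cod_pos, ?_⟩,
    ⟨wellTyped_swapPast hn hf.dom_pos, ⟨hf, hn⟩, ?_⟩, ?_, ?_⟩ <;> simp [dom, cod]

theorem isHom_braid (ha : ∀ n ∈ a, 0 < n) (hb : ∀ n ∈ b, 0 < n) :
    IsHom (braid a b) (a ++ b) (b ++ a) := by
  induction a with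
  | nil => simpa [braid] using IsHom.one hb
  | cons n a ih =>
    simp only [List.mem_cons, forall_eq_or_imp] at ha
    exact ((IsHom.one (pos_singleton ha.1)).mul (ih ha.2)).comp
      (by simpa using (isHom_past ha.1 hb).mul (.one ha.2))

theorem braid_natural (ha : ∀ n ∈ a, 0 < n) (hf : IsHom f b b') :
    (one a * f) ⊚ braid a b' = braid a b ⊚ (f * one a) := by
  induction a with
  | nil => simp [braid, one_nil, hf.comp_one, hf.one_comp]
  | cons n a ih =>
    simp only [List.mem_cons, forall_eq_or_imp] at ha
    have hn := pos_singleton ha.1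
    have hb := isHom_braid ha.2 hf.dom_pos
    have hb' := isHom_braid ha.2 hf.cod_pos
    have hp := isHom_past ha.1 hf.dom_pos
    have hp' := isHom_past ha.1 hf.cod_pos
    rw [braid, braid, one_cons, mul_assoc, ← DClass.comp_assoc,
      ← IsHom.one_mul_comp hn ((IsHom.one ha.2).mul hf) hb', ih ha.2,
      IsHom.one_mul_comp hn hb (hf.mul (.one ha.2)), DClass.comp_assoc, DClass.comp_assoc,
      ← mul_assoc, ← IsHom.comp_mul_one ha.2 ((IsHom.one hn).mul hf) hp', past_natural ha.1 hf,
      IsHom.comp_mul_one ha.2 hp (hf.mul (.one hn)), mul_assoc]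

theorem braid_append_left (ha : ∀ n ∈ a, 0 < n) (ha' : ∀ n ∈ a', 0 < n) (hb : ∀ n ∈ b, 0 < n) :
    braid (a ++ a') b = (one a * braid a' b) ⊚ (braid a b * one a') := by
  induction a with
  | nil =>
    rw [braid, ← one_append, one_nil, one_mul]
    exact (isHom_braid ha' hb).comp_one.symm
  | cons n a ih =>
    simp only [List.mem_cons, forall_eq_or_imp] at ha
    have hn := pos_singleton ha.1
    have h := isHom_braid ha.2 hb
    have h' := isHom_braid ha' hb
    have hp := isHom_past ha.1 hb
    rw [List.cons_append, braid, ih ha.2, braid, one_cons n a,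
      IsHom.one_mul_comp hn ((IsHom.one ha.2).mul h')
        (by simpa using h.mul (IsHom.one ha')),
      IsHom.comp_mul_one ha' ((IsHom.one hn).mul h)
        (by simpa using hp.mul (.one ha.2)), one_append]
    simp only [mul_assoc, DClass.comp_assoc]

theorem braid_append_right (ha : ∀ n ∈ a, 0 < n) (hb : ∀ n ∈ b, 0 < n) (hb' : ∀ n ∈ b', 0 < n) :
    braid a (b ++ b') = (braid a b * one b') ⊚ (one b * braid a b') := by
  induction a with
  | nil =>
    rw [braid, braid, braid, ← one_append, (IsHom.one (pos_append hb hb')).comp_one]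
  | cons n a ih =>
    simp only [List.mem_cons, forall_eq_or_imp] at ha
    have hn := pos_singleton ha.1
    have h := isHom_braid ha.2 hb
    have h' := isHom_braid ha.2 hb'
    have hp := isHom_past ha.1 hb
    have hp' := isHom_past ha.1 hb'
    have e : (one [n] * (one b * braid a b')) ⊚ (past n b * one b' * one a) =
        (past n b * one a * one b') ⊚ (one b * one [n] * braid a b') := by
      rw [mul_assoc, mul_assoc, ← one_append, ← one_append, ← one_append, ← mul_assoc,
        ← one_append]
      exact (hp.one_mul_comp_mul_one h').trans (hp.mul_one_comp_one_mul h').symm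
    rw [braid, ih ha.2, past_append ha.1 hb hb', braid, braid,
      IsHom.one_mul_comp hn (h.mul (.one hb')) (by simpa using (IsHom.one hb).mul h'),
      IsHom.comp_mul_one ha.2 (hp.mul (.one hb')) (by simpa using (IsHom.one hb).mul hp'),
      IsHom.comp_mul_one hb' ((IsHom.one hn).mul h) (by simpa using hp.mul (.one ha.2)),
      IsHom.one_mul_comp hb ((IsHom.one hn).mul h') (by simpa using hp'.mul (.one ha.2)),
      DClass.comp_assoc, ← DClass.comp_assoc (one [n] * (one b * braid a b')), e]
    simp only [mul_assoc, DClass.comp_assoc]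

theorem swap_comp_swap (hn : 0 < n) (hm : 0 < m) :
    cls (swap n m) ⊚ cls (swap m n) = one [n, m] := by
  rw [one_cons, ← cls_wire, ← cls_wire]
  exact cls_rule (.swap_swap n m) ⟨⟨⟨hn, hm⟩, ⟨hm, hn⟩, rfl⟩, ⟨hn, hm⟩, rfl, rfl⟩

theorem past_singleton (hn : 0 < n) (hm : 0 < m) : past n [m] = cls (swap n m) := by
  rw [past_cons, past_nil, ← one_append, one_nil, mul_one]
  exact (isHom_swap hn hm).comp_one

theorem braid_singleton_left (hn : 0 < n) (hb : ∀ n ∈ b, 0 < n) : braid [n] b = past n b := by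
  rw [braid, braid, ← one_append, one_nil, mul_one]
  exact (isHom_past hn hb).one_comp

theorem past_comp_braid (hn : 0 < n) (hb : ∀ n ∈ b, 0 < n) :
    past n b ⊚ braid b [n] = one (n :: b) := by
  induction b with
  | nil => rw [past_nil, braid, (IsHom.one (pos_singleton hn)).comp_one]
  | cons m b ih =>
    simp only [List.mem_cons, forall_eq_or_imp] at hb
    have hm := pos_singleton hb.1
    have hn' := pos_singleton hn
    rw [past_cons, braid, past_singleton hb.1 hn, DClass.comp_assoc,
      ← DClass.comp_assoc (one [m] * past n b),
      ← IsHom.one_mul_comp hm (isHom_past hn hb.2) (isHom_braid hb.2 hn'), ih hb.2, ← one_append,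
      IsHom.one_comp (a := [m] ++ n :: b) ((isHom_swap hb.1 hn).mul (IsHom.one hb.2)),
      ← IsHom.comp_mul_one hb.2 (isHom_swap hn hb.1) (isHom_swap hb.1 hn), swap_comp_swap hn hb.1,
      ← one_append]
    rfl

theorem braid_nil_right (hb : ∀ n ∈ b, 0 < n) : braid b [] = one b := by
  induction b with
  | nil => rfl
  | cons n b ih =>
    rw [braid, ih (by simp_all), past_nil, ← one_append]
    exact (IsHom.one hb).comp_one

theorem braid_comp_braid (ha : ∀ n ∈ a, 0 < n) (hb : ∀ n ∈ b, 0 < n) :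
    braid a b ⊚ braid b a = one (a ++ b) := by
  induction a with
  | nil => rw [braid, braid_nil_right hb, (IsHom.one hb).comp_one, List.nil_append]
  | cons n a ih =>
    simp only [List.mem_cons, forall_eq_or_imp] at ha
    have hn := pos_singleton ha.1
    have h := isHom_braid hb hn
    have hp := isHom_past ha.1 hb
    rw [braid, show n :: a = [n] ++ a from rfl, braid_append_right hb hn ha.2, DClass.comp_assoc,
      ← DClass.comp_assoc (past n b * one a), ← IsHom.comp_mul_one ha.2 hp h,
      past_comp_braid ha.1 hb, ← one_append, IsHom.one_comp (a := n :: b ++ a) (by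
        simpa using (IsHom.one hn).mul (isHom_braid hb ha.2)),
      ← IsHom.one_mul_comp hn (isHom_braid ha.2 hb) (isHom_braid hb ha.2), ih ha.2, ← one_append]
    rfl

theorem braid_natural_left (hb : ∀ n ∈ b, 0 < n) (hf : IsHom f a a') :
    (f * one b) ⊚ braid a' b = braid a b ⊚ (one b * f) := by
  have h := braid_natural hb hf
  have h1 := isHom_braid hf.dom_pos hb
  have h2 := isHom_braid hf.cod_pos hb
  have h3 := (IsHom.one hb).mul hf
  have h4 := hf.mul (IsHom.one hb)
  calc _ = (braid a b ⊚ braid b a) ⊚ ((f * one b) ⊚ braid a' b) := by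
        rw [braid_comp_braid hf.dom_pos hb, (h4.comp h2).one_comp]
    _ = braid a b ⊚ ((braid b a ⊚ (f * one b)) ⊚ braid a' b) := by
        simp only [DClass.comp_assoc]
    _ = _ := by
        rw [← h, DClass.comp_assoc, braid_comp_braid hb hf.cod_pos, h3.comp_one]

end

/-- The exchange of two types is an isomorphism. -/
def braidIso (X Y : Ty) : X ⊗ Y ≅ Y ⊗ X where
  hom := ⟨braid X.regs Y.regs, isHom_braid X.pos Y.pos⟩
  inv := ⟨braid Y.regs X.regs, isHom_braid Y.pos X.pos⟩
  hom_inv_id := hom_ext (braid_comp_braid X.pos Y.pos)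
  inv_hom_id := hom_ext (braid_comp_braid Y.pos X.pos)

instance : SymmetricCategory Ty where
  braiding := braidIso
  braiding_naturality_right X _ _ f := hom_ext (braid_natural X.pos f.isHom)
  braiding_naturality_left f Z := hom_ext (braid_natural_left Z.pos f.isHom)
  hexagon_forward X Y Z := hom_ext (by
    have h1 := (isHom_braid X.pos (Y ⊗ Z).pos)
    have h2 := ((isHom_braid X.pos Y.pos).mul (.one Z.pos))
    have h3 := ((IsHom.one Y.pos).mul (isHom_braid X.pos Z.pos))
    have e := braid_append_right X.pos Y.pos Z.pos
    simp only [regs_tensor, ← List.append_assoc] at h1 h2 h3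
    simp only [val_comp, val_associator_hom, braidIso, val_whiskerRight, val_whiskerLeft,
      regs_tensor, List.append_assoc] at *
    rw [h1.comp_one, h1.one_comp, h3.one_comp, e])
  hexagon_reverse X Y Z := hom_ext (by
    have h1 := (isHom_braid (X ⊗ Y).pos Z.pos)
    have h2 := ((isHom_braid X.pos Z.pos).mul (.one Y.pos))
    have h3 := ((IsHom.one X.pos).mul (isHom_braid Y.pos Z.pos))
    have e := braid_append_left X.pos Y.pos Z.pos
    simp only [regs_tensor, ← List.append_assoc] at h1 h2 h3
    simp only [val_comp, val_associator_inv, braidIso, val_whiskerRight, val_whiskerLeft,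
      regs_tensor, List.append_assoc] at *
    rw [h1.comp_one, h1.one_comp, h2.one_comp, e])
  symmetry X Y := (braidIso X Y).hom_inv_id

@[simp] theorem val_braiding (X Y : Ty) : Mor.val (β_ X Y).hom = braid X.regs Y.regs := rfl

/-! ### Spiders and scalars -/

/-- The class of the phaseless spider. -/
def sp (c : Colour) (n k l : ℕ) : DClass := cls (spider₀ c n k l)

section

variable {c : Colour} {n k l : ℕ} {s f g : DClass} {a b d : List ℕ}

theorem isHom_sp (hn : 0 < n) : IsHom (sp c n k l) (List.replicate k n) (List.replicate l n) :=
  .of_cls (f := spider₀ c n k l) hn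

theorem isHom_cap (hn : 0 < n) : IsHom (cls (cap n)) [n, n] [] := .of_cls (f := cap n) hn

theorem isHom_cup (hn : 0 < n) : IsHom (cls (cup n)) [] [n, n] := .of_cls (f := cup n) hn

theorem pos_replicate (hn : 0 < n) : ∀ m ∈ List.replicate k n, 0 < m := by
  intro m hm
  rwa [List.eq_of_mem_replicate hm]

theorem replicate_two_more (p q n : ℕ) :
    List.replicate (p + 2 + q) n = List.replicate p n ++ n :: n :: List.replicate q n := by
  rw [List.replicate_add, List.replicate_add, List.append_assoc]
  rfl

/-- A scalar can be moved through a diagram. -/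
theorem scalar_mul_comm (hs : IsHom s [] []) (hf : IsHom f a b) : s * f = f * s := by
  have h := braid_natural hf.dom_pos hs
  rw [braid_nil_right hf.dom_pos] at h
  have h1 : one a * s = s * one a := by
    have h2 := (IsHom.one hf.dom_pos).mul hs
    have h3 : IsHom (s * one a) a a := hs.mul (IsHom.one hf.dom_pos)
    rw [List.append_nil] at h2
    rwa [h2.comp_one, h3.one_comp] at h
  have h4 := hs.mul_one_comp_one_mul hf
  have h5 := hf.one_mul_comp_mul_one hs
  simp only [one_nil, one_mul, mul_one] at h4 h5
  rw [← h4, ← h5, h1]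

theorem scalar_mul_comp (hs : IsHom s [] []) (hf : IsHom f a b) (hg : IsHom g b d) :
    s * (f ⊚ g) = (s * f) ⊚ g := by
  have h := hs.interchange (IsHom.one (a := []) (by simp)) hf hg
  rw [hs.comp_one, one_nil, one_mul] at h
  exact h.symm

theorem scalar_mul_comp' (hs : IsHom s [] []) (hf : IsHom f a b) (hg : IsHom g b d) :
    s * (f ⊚ g) = f ⊚ (s * g) := by
  have h := (IsHom.one (a := []) (by simp)).interchange hs hf hg
  rw [hs.one_comp, one_nil, one_mul] at h
  exact h.symm

theorem spider_fusion (hn : 0 < n) (k₁ l₁ j k₂ l₂ : ℕ) :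
    (sp c n k₁ (l₁ + (j + 1)) * one (List.replicate k₂ n)) ⊚
      (one (List.replicate l₁ n) * sp c n ((j + 1) + k₂) l₂) = sp c n (k₁ + k₂) (l₁ + l₂) := by
  have h := cls_rule (.fusion c n k₁ l₁ j k₂ l₂ 0 0) ⟨⟨⟨hn, wellTyped_idn (pos_replicate hn)⟩,
    ⟨wellTyped_idn (pos_replicate hn), hn⟩,
    by simp [dom, cod, List.replicate_add, List.replicate_succ,
      -List.replicate_append_replicate]⟩, hn,
    by simp [dom, List.replicate_add, -List.replicate_append_replicate],
    by simp [cod, List.replicate_add, -List.replicate_append_replicate]⟩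
  rwa [add_zero] at h

theorem sp_one_one (hn : 0 < n) : sp c n 1 1 = one [n] := by
  rw [← cls_wire]
  exact cls_rule (.spider_wire c n) ⟨hn, hn, rfl, rfl⟩

theorem sp_comp_swap (hn : 0 < n) (p q : ℕ) :
    sp c n k (p + 2 + q) ⊚ (one (List.replicate p n) * cls (swap n n) * one (List.replicate q n)) =
      sp c n k (p + 2 + q) :=
  cls_rule (.spider_swap c n k p q 0) ⟨⟨hn, ⟨⟨wellTyped_idn (pos_replicate hn), hn, hn⟩,
    wellTyped_idn (pos_replicate hn)⟩, by simp [spider₀, dom, cod, replicate_two_more]⟩, hn, rfl,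
    by simp [spider₀, cod, replicate_two_more]⟩

theorem swap_comp_sp (hn : 0 < n) (p q : ℕ) :
    (one (List.replicate p n) * cls (swap n n) * one (List.replicate q n)) ⊚ sp c n (p + 2 + q) l =
      sp c n (p + 2 + q) l :=
  cls_rule (.swap_spider c n l p q 0) ⟨⟨⟨⟨wellTyped_idn (pos_replicate hn), hn, hn⟩,
    wellTyped_idn (pos_replicate hn)⟩, hn, by simp [spider₀, dom, cod, replicate_two_more]⟩, hn,
    by simp [spider₀, dom, replicate_two_more], rfl⟩

theorem sp_comp_cap (hn : 0 < n) (k l : ℕ) :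
    (one [n] * sp c n k (l + 1)) ⊚ (cls (cap n) * one (List.replicate l n)) = sp c n (k + 1) l := by
  rw [← cls_wire]
  exact cls_rule (.spider_cap c n k l 0) ⟨⟨⟨hn, hn⟩, ⟨hn, wellTyped_idn (pos_replicate hn)⟩,
    by simp [spider₀, dom, cod, List.replicate_succ]⟩, hn,
    by simp [spider₀, dom, List.replicate_succ], by simp [spider₀, cod]⟩

theorem cup_comp_sp (hn : 0 < n) (k l : ℕ) :
    (cls (cup n) * one (List.replicate k n)) ⊚ (one [n] * sp c n (k + 1) l) = sp c n k (l + 1) := by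
  rw [← cls_wire]
  exact cls_rule (.cup_spider c n k l 0) ⟨⟨⟨hn, wellTyped_idn (pos_replicate hn)⟩, ⟨hn, hn⟩,
    by simp [spider₀, dom, cod, List.replicate_succ]⟩, hn, by simp [spider₀, dom],
    by simp [spider₀, cod, List.replicate_succ]⟩

theorem cap_eq (c : Colour) (hn : 0 < n) : cls (cap n) = sp c n 2 0 := by
  rw [← sp_comp_cap hn 1 0, sp_one_one hn, List.replicate_zero, one_nil, mul_one, ← one_append]
  exact (isHom_cap hn).one_comp.symm

theorem cup_eq (c : Colour) (hn : 0 < n) : cls (cup n) = sp c n 0 2 := by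
  rw [← cup_comp_sp hn 0 1, sp_one_one hn, List.replicate_zero, one_nil, mul_one, ← one_append]
  exact (isHom_cup hn).comp_one.symm

theorem sp_one_two_comp_right (hn : 0 < n) (l : ℕ) :
    sp c n 1 2 ⊚ (one [n] * sp c n 1 l) = sp c n 1 (1 + l) := by
  simpa [one_nil] using spider_fusion (c := c) hn 1 1 0 0 l

theorem sp_one_two_comp_swap (hn : 0 < n) : sp c n 1 2 ⊚ cls (swap n n) = sp c n 1 2 := by
  simpa [one_nil] using sp_comp_swap (c := c) (k := 1) hn 0 0

theorem swap_comp_sp_two_one (hn : 0 < n) : cls (swap n n) ⊚ sp c n 2 1 = sp c n 2 1 := by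
  simpa [one_nil] using swap_comp_sp (c := c) (l := 1) hn 0 0

theorem sp_one_two_comp_left_one_two (hn : 0 < n) :
    sp c n 1 2 ⊚ (sp c n 1 2 * one [n]) = sp c n 1 3 := by
  have h12 : IsHom (sp c n 1 2) [n] [n, n] := isHom_sp hn
  have hw := isHom_swap hn hn
  have hp := pos_singleton hn
  -- exchange the two legs, and slide the second spider through the exchange
  have e := past_natural (f := sp c n 1 2) hn h12
  rw [past_singleton hn hn] at e
  rw [← sp_one_two_comp_swap hn, DClass.comp_assoc, sp_one_two_comp_swap hn, ← e,
    ← DClass.comp_assoc, sp_one_two_comp_right hn, past_cons, past_singleton hn hn,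
    ← DClass.comp_assoc]
  have h1 := sp_comp_swap (c := c) (k := 1) hn 0 1
  have h2 := sp_comp_swap (c := c) (k := 1) hn 1 0
  simp only [List.replicate_zero, List.replicate_one, one_nil, mul_one, one_mul] at h1 h2
  rw [show 1 + 2 = 0 + 2 + 1 from rfl, h1]
  exact h2

theorem sp_two_one_comp_left (hn : 0 < n) (l : ℕ) :
    (sp c n 2 1 * one [n]) ⊚ sp c n 2 l = sp c n 3 l := by
  simpa [one_nil] using spider_fusion (c := c) hn 2 0 0 1 l

theorem sp_two_one_comp_right_two_one (hn : 0 < n) :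
    (one [n] * sp c n 2 1) ⊚ sp c n 2 1 = sp c n 3 1 := by
  have h21 : IsHom (sp c n 2 1) [n, n] [n] := isHom_sp hn
  have hw := isHom_swap hn hn
  have hp := pos_singleton hn
  have e := past_natural (f := sp c n 2 1) hn h21
  rw [past_singleton hn hn] at e
  rw [← swap_comp_sp_two_one hn, ← DClass.comp_assoc, swap_comp_sp_two_one hn, e,
    DClass.comp_assoc, sp_two_one_comp_left hn, past_cons, past_singleton hn hn,
    DClass.comp_assoc]
  have h1 := swap_comp_sp (c := c) (l := 1) hn 0 1
  have h2 := swap_comp_sp (c := c) (l := 1) hn 1 0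
  simp only [List.replicate_zero, List.replicate_one, one_nil, mul_one, one_mul] at h1 h2
  rw [h2]
  exact h1

theorem sp_comp_right_counit (hn : 0 < n) (k : ℕ) :
    sp c n k 2 ⊚ (one [n] * sp c n 1 0) = sp c n k 1 := by
  simpa [one_nil] using spider_fusion (c := c) hn k 1 0 0 0

theorem sp_comp_left_counit (hn : 0 < n) :
    sp c n 1 2 ⊚ (sp c n 1 0 * one [n]) = one [n] := by
  have h10 : IsHom (sp c n 1 0) [n] [] := isHom_sp hn
  have e := braid_natural (pos_singleton hn) h10
  have h12 := sp_one_two_comp_swap (c := c) hn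
  rw [← past_singleton hn hn, ← braid_singleton_left hn (pos_singleton hn)] at h12
  rw [← h12, DClass.comp_assoc, ← e, ← DClass.comp_assoc, sp_comp_right_counit hn,
    braid_nil_right (pos_singleton hn), sp_one_one hn, (IsHom.one (pos_singleton hn)).comp_one]

theorem unit_comp_sp (hn : 0 < n) (k l : ℕ) :
    (sp c n 0 1 * one (List.replicate k n)) ⊚ sp c n (1 + k) l = sp c n k l := by
  simpa [one_nil] using spider_fusion (c := c) hn 0 0 0 k l

theorem sp_zero_one_comp (hn : 0 < n) (l : ℕ) : sp c n 0 1 ⊚ sp c n 1 l = sp c n 0 l := by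
  simpa [one_nil] using unit_comp_sp (c := c) hn 0 l

theorem sp_comp_counit (hn : 0 < n) (k l : ℕ) : sp c n k 1 ⊚ sp c n 1 l = sp c n k l := by
  simpa [one_nil] using spider_fusion (c := c) hn k 0 0 0 l

theorem had_comp_had (hn : 0 < n) : cls (had n) ⊚ cls (had n) = one [n] := by
  have hh : IsHom (cls (had n)) [n] [n] := .of_cls (f := had n) hn
  have h : (cls (had n) * 1) ⊚ sp .green n 1 1 ⊚ (cls (had n) * 1) = sp .red n 1 1 :=
    cls_rule (.had_spider .green n 1 1 0) ⟨⟨⟨⟨hn, trivial⟩, hn, rfl⟩, ⟨hn, trivial⟩, rfl⟩, hn,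
      rfl, rfl⟩
  rwa [sp_one_one hn, sp_one_one hn, mul_one, hh.comp_one] at h

end

/-! ### The interaction of the two colours on a single qubit -/

/-- The scalar `√2`. -/
def sqrtTwo : DClass := cls (bone .green 1)

/-- The scalar `1 / √2`. -/
def invSqrtTwo : DClass := cls (tribone .green 1)

theorem isHom_sqrtTwo : IsHom sqrtTwo [] [] :=
  .of_cls (f := bone .green 1) ⟨Nat.one_pos, Nat.one_pos, rfl⟩

theorem isHom_invSqrtTwo : IsHom invSqrtTwo [] [] :=
  .of_cls (f := tribone .green 1) ⟨Nat.one_pos, Nat.one_pos, rfl⟩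

theorem sqrtTwo_mul_invSqrtTwo : sqrtTwo * invSqrtTwo = 1 :=
  cls_rule (.scalar .green) (by simp [WellTyped, bone, tribone, spider₀, dom, cod])

theorem invSqrtTwo_mul_sqrtTwo : invSqrtTwo * sqrtTwo = 1 := by
  rw [scalar_mul_comm isHom_invSqrtTwo isHom_sqrtTwo, sqrtTwo_mul_invSqrtTwo]

theorem bone_red : cls (bone .red 1) = sqrtTwo := by
  have h1 : 1 ⊚ sp .green 1 0 1 ⊚ (cls (had 1) * 1) = sp .red 1 0 1 :=
    cls_rule (.had_spider .green 1 0 1 0)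
      (by simp [WellTyped, spider₀, dom, cod])
  have h2 : (cls (had 1) * 1) ⊚ sp .green 1 1 0 ⊚ 1 = sp .red 1 1 0 :=
    cls_rule (.had_spider .green 1 1 0 0)
      (by simp [WellTyped, spider₀, dom, cod])
  have g01 : IsHom (sp .green 1 0 1) [] [1] := isHom_sp one_pos
  have g10 : IsHom (sp .green 1 1 0) [1] [] := isHom_sp one_pos
  rw [← one_nil, g01.one_comp, one_nil, mul_one] at h1
  rw [mul_one, DClass.comp_assoc, ← one_nil, g10.comp_one] at h2
  change sp .red 1 0 1 ⊚ sp .green 1 1 0 = sp .green 1 0 1 ⊚ sp .red 1 1 0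
  rw [← h1, ← h2, DClass.comp_assoc]

theorem green_unit_copy :
    sqrtTwo * (sp .green 1 0 1 ⊚ sp .red 1 1 2) = sp .green 1 0 1 * sp .green 1 0 1 := by
  rw [← bone_red]
  exact cls_rule (.copy .red) (by simp [WellTyped, bone, spider₀, dom, cod, Colour.other])

theorem red_unit_copy :
    sqrtTwo * (sp .red 1 0 1 ⊚ sp .green 1 1 2) = sp .red 1 0 1 * sp .red 1 0 1 :=
  cls_rule (.copy .green) (by simp [WellTyped, bone, spider₀, dom, cod, Colour.other])

theorem red_green_bialgebra :
    sp .red 1 2 1 ⊚ sp .green 1 1 2 = sqrtTwo * ((sp .green 1 1 2 * sp .green 1 1 2) ⊚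
      (one [1] * cls (swap 1 1) * one [1]) ⊚ (sp .red 1 2 1 * sp .red 1 2 1)) := by
  rw [← cls_wire]
  exact cls_rule (.bialgebra .green) (by simp [WellTyped, bone, spider₀, dom, cod, Colour.other])

/-- Adding a uniformly distributed bit to a bit gives a uniformly distributed bit, independent of
it. -/
theorem green_unit_add : sqrtTwo * ((one [1] * sp .green 1 0 1) ⊚ sp .red 1 2 1) =
    sp .green 1 1 0 * sp .green 1 0 1 := by
  have p1 : ∀ k ∈ [1], 0 < k := by simp
  have g01 : IsHom (sp .green 1 0 1) [] [1] := isHom_sp one_pos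
  have r12 : IsHom (sp .red 1 1 2) [1] [1, 1] := isHom_sp one_pos
  have r21 : IsHom (sp .red 1 2 1) [1, 1] [1] := isHom_sp one_pos
  have hc := isHom_cap one_pos
  have h1 : (one [1] * sp .red 1 1 2) ⊚ (cls (cap 1) * one [1]) = sp .red 1 2 1 :=
    sp_comp_cap one_pos 1 1
  have h2 : (one [1] * sp .green 1 0 1) ⊚ cls (cap 1) = sp .green 1 1 0 := by
    simpa [one_nil] using sp_comp_cap (c := .green) one_pos 0 0
  have hcw : IsHom (cls (cap 1) * one [1]) [1, 1, 1] [1] := hc.mul (.one p1)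
  rw [← h1, ← DClass.comp_assoc, ← IsHom.one_mul_comp p1 g01 r12,
    scalar_mul_comp isHom_sqrtTwo ((IsHom.one p1).mul (g01.comp r12)) hcw, ← mul_assoc,
    scalar_mul_comm isHom_sqrtTwo (.one p1), mul_assoc, green_unit_copy, ← mul_assoc,
    IsHom.interchange ((IsHom.one p1).mul g01) hc g01 (.one p1), h2, g01.comp_one]

/-- Erasing the sum of two bits erases both. By `green_unit_add`, as erasing a bit is pairing it
with the green unit. -/
theorem red_merge_counit : sqrtTwo * (sp .red 1 2 1 ⊚ sp .green 1 1 0) =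
    sp .green 1 1 0 * sp .green 1 1 0 := by
  have p1 : ∀ k ∈ [1], 0 < k := by simp
  have g01 : IsHom (sp .green 1 0 1) [] [1] := isHom_sp one_pos
  have g10 : IsHom (sp .green 1 1 0) [1] [] := isHom_sp one_pos
  have r21 : IsHom (sp .red 1 2 1) [1, 1] [1] := isHom_sp one_pos
  have hc := isHom_cap one_pos
  have h2 : (one [1] * sp .green 1 0 1) ⊚ cls (cap 1) = sp .green 1 1 0 := by
    simpa [one_nil] using sp_comp_cap (c := .green) one_pos 0 0
  have h3 : (one [1] * sp .red 1 2 1) ⊚ cls (cap 1) = sp .red 1 3 0 := by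
    simpa [one_nil] using sp_comp_cap (c := .red) one_pos 2 0
  have h4 : (sp .red 1 2 1 * one [1]) ⊚ cls (cap 1) = sp .red 1 3 0 := by
    rw [cap_eq .red one_pos, sp_two_one_comp_left one_pos]
  have e1 : sp .red 1 2 1 ⊚ (one [1] * sp .green 1 0 1) =
      (one [1, 1] * sp .green 1 0 1) ⊚ (sp .red 1 2 1 * one [1]) := by
    rw [r21.one_mul_comp_mul_one g01, ← r21.mul_one_comp_one_mul g01, one_nil, mul_one]
  have i1 : IsHom (one [1] * sp .green 1 0 1) [1] [1, 1] := (IsHom.one p1).mul g01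
  have i2 : IsHom (one [1] * ((one [1] * sp .green 1 0 1) ⊚ sp .red 1 2 1)) [1, 1] [1, 1] :=
    (IsHom.one p1).mul (i1.comp r21)
  have i3 : IsHom (one [1] * sp .green 1 1 0) [1, 1] [1] := (IsHom.one p1).mul g10
  have e2 : one [1] * (sp .green 1 1 0 * sp .green 1 0 1) =
      (one [1] * sp .green 1 1 0) ⊚ (one [1] * sp .green 1 0 1) := by
    rw [← IsHom.one_mul_comp p1 g10 g01, ← g10.mul_one_comp_one_mul g01, one_nil, one_mul, mul_one]
  rw [← h2, ← DClass.comp_assoc, e1, DClass.comp_assoc, h4, ← h3, ← DClass.comp_assoc,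
    one_cons 1 [1], mul_assoc, ← IsHom.one_mul_comp p1 i1 r21, scalar_mul_comp isHom_sqrtTwo i2 hc,
    ← mul_assoc, scalar_mul_comm isHom_sqrtTwo (.one p1), mul_assoc, green_unit_add,
    e2, DClass.comp_assoc, h2]
  have h5 := g10.one_mul_comp_mul_one g10
  rwa [one_nil, mul_one] at h5

/-- The snake equation with a crossing between cup and cap. -/
theorem crossed_snake {n : ℕ} (hn : 0 < n) : (one [n] * cls (cup n)) ⊚
    (cls (swap n n) * one [n]) ⊚ (one [n] * cls (cap n)) = one [n] := by
  have hp := pos_singleton hn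
  have hs := isHom_swap hn hn
  have hcup := isHom_cup hn
  have hcap := isHom_cap hn
  have h1 := past_natural hn hcup
  have i1 : IsHom (cls (swap n n) * one [n]) [n, n, n] [n, n, n] := hs.mul (.one hp)
  have i2 : IsHom (one [n] * cls (swap n n)) [n, n, n] [n, n, n] := (IsHom.one hp).mul hs
  have i3 : IsHom (cls (cup n) * one [n]) [n] [n, n, n] := hcup.mul (.one hp)
  rw [past_nil, past_cons, past_singleton hn hn, i3.one_comp] at h1
  have h2 : cls (swap n n) ⊚ cls (cap n) = cls (cap n) :=
    cls_rule (.swap_cap n) ⟨⟨⟨hn, hn⟩, hn, rfl⟩, hn, rfl, rfl⟩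
  have h3 : (cls (cup n) * one [n]) ⊚ (one [n] * cls (cap n)) = one [n] := by
    rw [← cls_wire]
    exact cls_rule (.snake_left n) ⟨⟨⟨hn, hn⟩, ⟨hn, hn⟩, rfl⟩, hn, rfl, rfl⟩
  refine Eq.trans ?_ h3
  rw [← h1]
  simp only [DClass.comp_assoc]
  rw [← IsHom.one_mul_comp hp hs hcap, h2]

/-- The Hopf law: adding a bit to itself gives `0`. -/
theorem hopf_law : sqrtTwo * (sp .green 1 1 2 ⊚ sp .red 1 2 1) =
    invSqrtTwo * (sp .green 1 1 0 ⊚ sp .red 1 0 1) := by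
  have p1 : ∀ k ∈ [1], 0 < k := by simp
  have p2 : ∀ k ∈ [1, 1], 0 < k := by simp
  have g01 : IsHom (sp .green 1 0 1) [] [1] := isHom_sp one_pos
  have g10 : IsHom (sp .green 1 1 0) [1] [] := isHom_sp one_pos
  have g12 : IsHom (sp .green 1 1 2) [1] [1, 1] := isHom_sp one_pos
  have r10 : IsHom (sp .red 1 1 0) [1] [] := isHom_sp one_pos
  have r01 : IsHom (sp .red 1 0 1) [] [1] := isHom_sp one_pos
  have r21 : IsHom (sp .red 1 2 1) [1, 1] [1] := isHom_sp one_pos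
  have hcap := isHom_cap one_pos
  have hcup := isHom_cup one_pos
  have hsw := isHom_swap one_pos one_pos
  have i1 : IsHom (one [1] * sp .green 1 0 1) [1] [1, 1] := (IsHom.one p1).mul g01
  have i2 : IsHom (one [1] * sp .red 1 1 0) [1, 1] [1] := (IsHom.one p1).mul r10
  have i3 : IsHom (one [1] * cls (swap 1 1) * one [1]) [1, 1, 1, 1] [1, 1, 1, 1] :=
    ((IsHom.one p1).mul hsw).mul (.one p1)
  have i4 : IsHom (sp .green 1 1 2 * sp .green 1 1 2) [1, 1] [1, 1, 1, 1] := g12.mul g12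
  have i5 : IsHom (sp .red 1 2 1 * sp .red 1 2 1) [1, 1, 1, 1] [1, 1] := r21.mul r21
  -- The diagram `E` adds a uniform bit, copies the sum and pairs one copy with the red counit. It
  -- is evaluated by `green_unit_add`, and by the bialgebra rule.
  set E := (one [1] * sp .green 1 0 1) ⊚ (sp .red 1 2 1 ⊚ sp .green 1 1 2) ⊚
    (one [1] * sp .red 1 1 0) with hE
  have w1 : sqrtTwo * E = sp .green 1 1 0 ⊚ sp .red 1 0 1 := by
    have e1 : sp .green 1 1 0 * sp .green 1 0 1 = sp .green 1 1 0 ⊚ sp .green 1 0 1 := by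
      rw [← g10.mul_one_comp_one_mul g01, one_nil, one_mul, mul_one]
    rw [hE, ← DClass.comp_assoc, DClass.comp_assoc _ (sp .green 1 1 2),
      scalar_mul_comp isHom_sqrtTwo (i1.comp r21) (g12.comp i2), green_unit_add, e1,
      DClass.comp_assoc, ← DClass.comp_assoc (sp .green 1 0 1), sp_zero_one_comp one_pos,
      ← cup_eq .green one_pos, cup_eq .red one_pos, sp_comp_right_counit one_pos]
  have w2 : E = sqrtTwo * (sp .green 1 1 2 ⊚ sp .red 1 2 1) := by
    have e1 : (one [1] * sp .green 1 0 1) ⊚ (sp .green 1 1 2 * sp .green 1 1 2) =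
        sp .green 1 1 2 ⊚ (one [1, 1] * cls (cup 1)) := by
      rw [IsHom.interchange (.one p1) g12 g01 g12, sp_zero_one_comp one_pos, g12.one_comp,
        ← cup_eq .green one_pos, ← g12.mul_one_comp_one_mul hcup, one_nil, mul_one]
    have e2 : (sp .red 1 2 1 * sp .red 1 2 1) ⊚ (one [1] * sp .red 1 1 0) =
        (one [1, 1] * cls (cap 1)) ⊚ sp .red 1 2 1 := by
      rw [IsHom.interchange r21 (.one p1) r21 r10, sp_comp_counit one_pos, r21.comp_one,
        ← cap_eq .red one_pos, ← r21.one_mul_comp_mul_one hcap, one_nil, mul_one]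
    have e3 : (one [1, 1] * cls (cup 1)) ⊚ (one [1] * cls (swap 1 1) * one [1]) ⊚
        (one [1, 1] * cls (cap 1)) = one [1, 1] := by
      have j1 : IsHom (one [1] * cls (cup 1)) [1] [1, 1, 1] := (IsHom.one p1).mul hcup
      have j2 : IsHom (cls (swap 1 1) * one [1]) [1, 1, 1] [1, 1, 1] := hsw.mul (.one p1)
      have j3 : IsHom (one [1] * cls (cap 1)) [1, 1, 1] [1] := (IsHom.one p1).mul hcap
      rw [one_cons 1 [1], mul_assoc, mul_assoc, mul_assoc, ← IsHom.one_mul_comp p1 j1 j2,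
        ← IsHom.one_mul_comp p1 (j1.comp j2) j3, crossed_snake one_pos]
    have j4 : IsHom (one [1, 1] * cls (cup 1)) [1, 1] [1, 1, 1, 1] := (IsHom.one p2).mul hcup
    rw [hE, red_green_bialgebra, ← scalar_mul_comp' isHom_sqrtTwo i1 ((i4.comp i3).comp i5),
      ← scalar_mul_comp isHom_sqrtTwo (i1.comp ((i4.comp i3).comp i5)) i2]
    congr 1
    rw [DClass.comp_assoc, DClass.comp_assoc _ _ (one [1] * sp .red 1 1 0), e2,
      DClass.comp_assoc, ← DClass.comp_assoc (one [1] * sp .green 1 0 1), e1,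
      DClass.comp_assoc, ← DClass.comp_assoc (one [1] * cls (swap 1 1) * one [1]),
      ← DClass.comp_assoc (one [1, 1] * cls (cup 1)),
      ← DClass.comp_assoc (one [1, 1] * cls (cup 1)),
      e3, r21.one_comp]
  rw [← w1, w2, ← mul_assoc, invSqrtTwo_mul_sqrtTwo, one_mul]

/-! ### Cartesian reasoning with comonoid homomorphisms -/

section Cartesian

open ComonObj
open scoped MonObj

universe v w

variable {C : Type w} [Category.{v} C] [MonoidalCategory C]

attribute [local instance] ComonObj.instTensorUnit

variable {W X Y Z Y' Z' : C}

/-- The pairing of two morphisms from a comonoid. -/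
def pair [ComonObj X] (f : X ⟶ Y) (g : X ⟶ Z) : X ⟶ Y ⊗ Z := Δ[X] ≫ (f ⊗ₘ g)

variable (Y Z) in
/-- The first projection, which discards the second factor. -/
def pfst [ComonObj Z] : Y ⊗ Z ⟶ Y := (Y ◁ ε[Z]) ≫ (ρ_ Y).hom

variable (Y Z) in
/-- The second projection, which discards the first factor. -/
def psnd [ComonObj Y] : Y ⊗ Z ⟶ Z := (ε[Y] ▷ Z) ≫ (λ_ Z).hom

theorem pair_comp_tensorHom [ComonObj X] (f : X ⟶ Y) (g : X ⟶ Z) (f' : Y ⟶ Y') (g' : Z ⟶ Z') :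
    pair f g ≫ (f' ⊗ₘ g') = pair (f ≫ f') (g ≫ g') := by
  simp [pair]

theorem comp_pair [ComonObj W] [ComonObj X] (h : W ⟶ X) [IsComonHom h] (f : X ⟶ Y) (g : X ⟶ Z) :
    h ≫ pair f g = pair (h ≫ f) (h ≫ g) := by
  simp [pair, IsComonHom.hom_comul_assoc]

@[simp] theorem pair_pfst [ComonObj X] [ComonObj Z] (f : X ⟶ Y) (g : X ⟶ Z) [IsComonHom g] :
    pair f g ≫ pfst Y Z = f := by
  rw [pfst, ← id_tensorHom, ← Category.assoc, pair_comp_tensorHom, IsComonHom.hom_counit,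
    Category.comp_id, pair, comul_counit_hom]
  simp

@[simp] theorem pair_psnd [ComonObj X] [ComonObj Y] (f : X ⟶ Y) (g : X ⟶ Z) [IsComonHom f] :
    pair f g ≫ psnd Y Z = g := by
  rw [psnd, ← tensorHom_id, ← Category.assoc, pair_comp_tensorHom, IsComonHom.hom_counit,
    Category.comp_id, pair, counit_comul_hom]
  simp

/-- An isomorphism that preserves the comultiplications preserves the counits. -/
theorem isComonHom_of_iso [ComonObj X] [ComonObj Y] (f : X ≅ Y)
    (h : f.hom ≫ Δ[Y] = Δ[X] ≫ (f.hom ⊗ₘ f.hom)) : IsComonHom f.hom where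
  hom_comul := h
  hom_counit := by
    have h1 : Δ[X] ≫ (𝟙 X ⊗ₘ (f.hom ≫ ε[Y])) = (ρ_ X).inv := by
      have e : (𝟙 X ⊗ₘ (f.hom ≫ ε[Y])) = (f.hom ⊗ₘ f.hom) ≫ Y ◁ ε[Y] ≫ f.inv ▷ 𝟙_ C := by
        rw [← id_tensorHom, ← tensorHom_id, tensorHom_comp_tensorHom, tensorHom_comp_tensorHom]
        simp
      rw [e, ← reassoc_of% h, comul_counit_assoc, ← rightUnitor_inv_naturality,
        Iso.hom_inv_id_assoc]
    have h2 := counit_comul_hom (f.hom ≫ ε[Y])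
    have e : (ε[X] ⊗ₘ (f.hom ≫ ε[Y])) = (𝟙 X ⊗ₘ (f.hom ≫ ε[Y])) ≫ (ε[X] ▷ 𝟙_ C) := by
      rw [← tensorHom_id, tensorHom_comp_tensorHom, Category.id_comp, Category.comp_id]
    rw [e, reassoc_of% h1, ← rightUnitor_inv_naturality, unitors_inv_equal] at h2
    exact ((cancel_mono _).1 h2).symm

variable [SymmetricCategory C]

theorem pair_pfst_psnd [ComonObj Y] [ComonObj Z] : pair (pfst Y Z) (psnd Y Z) = 𝟙 (Y ⊗ Z) := by
  have h : (pfst Y Z ⊗ₘ psnd Y Z) = ((𝟙 Y ⊗ₘ ε[Z]) ⊗ₘ (ε[Y] ⊗ₘ 𝟙 Z)) ≫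
      ((ρ_ Y).hom ⊗ₘ (λ_ Z).hom) := by simp [pfst, psnd]
  rw [pair, h, Comon.tensorObj_comul, Category.assoc, ← tensorμ_natural_assoc,
    tensorHom_comp_tensorHom_assoc, id_tensorHom, comul_counit, tensorHom_id, counit_comul]
  simp only [tensorμ, braiding_tensorUnit_left]
  monoidal

/-- A comonoid homomorphism into a product is the pairing of its components. -/
theorem eq_pair [ComonObj X] [ComonObj Y] [ComonObj Z] (f : X ⟶ Y ⊗ Z) [IsComonHom f] :
    f = pair (f ≫ pfst Y Z) (f ≫ psnd Y Z) := by
  rw [← comp_pair, pair_pfst_psnd, Category.comp_id]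

/-- Exchange of the middle components: this needs only cocommutativity of the source. -/
theorem pair_pair_tensorμ [ComonObj X] [IsCommComonObj X] (a : X ⟶ Y) (b : X ⟶ Z) (c : X ⟶ Y')
    (d : X ⟶ Z') :
    pair (pair a b) (pair c d) ≫ tensorμ Y Z Y' Z' = pair (pair a c) (pair b d) := by
  have h : Δ[X] ≫ (Δ[X] ⊗ₘ Δ[X]) ≫ tensorμ X X X X = Δ[X] ≫ (Δ[X] ⊗ₘ Δ[X]) := by
    have h1 : Δ[X] ≫ (Δ[X] ⊗ₘ Δ[X]) =
        Δ[X] ≫ X ◁ Δ[X] ≫ X ◁ Δ[X] ▷ X ≫ X ◁ (α_ X X X).hom ≫ (α_ X X (X ⊗ X)).inv := by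
      have h2 : X ◁ Δ[X] ≫ X ◁ Δ[X] ▷ X ≫ X ◁ (α_ X X X).hom = X ◁ Δ[X] ≫ X ◁ X ◁ Δ[X] := by
        simp only [← whiskerLeft_comp, comul_assoc]
      rw [reassoc_of% h2, comul_assoc_assoc, ← associator_naturality_right_assoc,
        Iso.hom_inv_id, Category.comp_id, MonoidalCategory.tensorHom_def]
    rw [reassoc_of% h1]
    simp only [tensorμ, Iso.inv_hom_id_assoc, ← whiskerLeft_comp_assoc, Iso.hom_inv_id_assoc,
      ← comp_whiskerRight_assoc, IsCommComonObj.comul_comm]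
    simp only [whiskerLeft_comp, Category.assoc]
    rw [h1]
  have e : pair (pair a b) (pair c d) =
      (Δ[X] ≫ (Δ[X] ⊗ₘ Δ[X])) ≫ ((a ⊗ₘ b) ⊗ₘ (c ⊗ₘ d)) := by
    rw [Category.assoc, tensorHom_comp_tensorHom]
    rfl
  rw [e, Category.assoc, tensorμ_natural, ← Category.assoc, Category.assoc Δ[X], h, Category.assoc,
    tensorHom_comp_tensorHom]
  rfl

theorem pair_comp_braiding [ComonObj X] [IsCommComonObj X] (f : X ⟶ Y) (g : X ⟶ Z) :
    pair f g ≫ (β_ Y Z).hom = pair g f := by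
  rw [pair, Category.assoc, BraidedCategory.braiding_naturality, ← Category.assoc,
    IsCommComonObj.comul_comm, pair]

instance isComonHom_tensorHom [ComonObj Y] [ComonObj Z] [ComonObj Y'] [ComonObj Z'] (f : Y ⟶ Y')
    (g : Z ⟶ Z') [IsComonHom f] [IsComonHom g] : IsComonHom (f ⊗ₘ g) where
  hom_counit := by simp
  hom_comul := by
    rw [Comon.tensorObj_comul, Comon.tensorObj_comul, Category.assoc, ← tensorμ_natural,
      tensorHom_comp_tensorHom_assoc, tensorHom_comp_tensorHom_assoc, IsComonHom.hom_comul,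
      IsComonHom.hom_comul]

instance isComonHom_counit [ComonObj X] : IsComonHom ε[X] where
  hom_comul := by
    change _ ≫ (λ_ (𝟙_ C)).inv = _
    rw [MonoidalCategory.tensorHom_def, ← Category.assoc, counit_comul, leftUnitor_inv_naturality]

theorem isComonHom_rightUnitor [ComonObj Y] : IsComonHom (ρ_ Y).hom where
  hom_counit := by
    rw [← rightUnitor_naturality, Comon.tensorObj_counit, unitors_equal, ← tensorHom_id]
    rfl
  hom_comul := by
    rw [Comon.tensorObj_comul, ← rightUnitor_naturality, tensor_right_unitality, Category.assoc,
      MonoidalCategory.tensorHom_def Δ[Y], Category.assoc]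
    rfl

theorem isComonHom_leftUnitor [ComonObj Y] : IsComonHom (λ_ Y).hom where
  hom_counit := by
    rw [← leftUnitor_naturality, Comon.tensorObj_counit, ← id_tensorHom]
    rfl
  hom_comul := by
    rw [Comon.tensorObj_comul, ← leftUnitor_naturality, tensor_left_unitality, Category.assoc,
      MonoidalCategory.tensorHom_def' _ Δ[Y], Category.assoc]
    rfl

instance isComonHom_pfst [ComonObj Y] [ComonObj Z] : IsComonHom (pfst Y Z) := by
  have := isComonHom_rightUnitor (Y := Y)
  rw [pfst, ← id_tensorHom]
  infer_instance

instance isComonHom_psnd [ComonObj Y] [ComonObj Z] : IsComonHom (psnd Y Z) := by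
  have := isComonHom_leftUnitor (Y := Z)
  rw [psnd, ← tensorHom_id]
  infer_instance

instance isComonHom_pair [ComonObj X] [IsCommComonObj X] [ComonObj Y] [ComonObj Z] (f : X ⟶ Y)
    (g : X ⟶ Z) [IsComonHom f] [IsComonHom g] : IsComonHom (pair f g) where
  hom_counit := by
    rw [Comon.tensorObj_counit, ← Category.assoc, pair_comp_tensorHom, IsComonHom.hom_counit,
      IsComonHom.hom_counit, pair, comul_counit_hom]
    simp [unitors_equal]
  hom_comul := by
    have h : pair f g ≫ (Δ[Y] ⊗ₘ Δ[Z]) = pair (pair f f) (pair g g) := by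
      rw [pair_comp_tensorHom, IsComonHom.hom_comul, IsComonHom.hom_comul, pair]
      rfl
    rw [Comon.tensorObj_comul, ← Category.assoc, h, pair_pair_tensorμ]
    rfl

/-- Pairing with a projection duplicates only the factor that is kept. -/
theorem pair_psnd_eq [ComonObj Y] [ComonObj Z] (h : Y ⊗ Z ⟶ W) :
    pair h (psnd Y Z) = (Y ◁ Δ[Z]) ≫ (α_ Y Z Z).inv ≫ h ▷ Z := by
  have e : (h ⊗ₘ psnd Y Z) =
      ((𝟙 Y ⊗ₘ 𝟙 Z) ⊗ₘ (ε[Y] ⊗ₘ 𝟙 Z)) ≫ (Y ⊗ Z) ◁ (λ_ Z).hom ≫ h ▷ Z := by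
    simp [psnd, MonoidalCategory.tensorHom_def']
  rw [pair, e, Comon.tensorObj_comul, Category.assoc, ← tensorμ_natural_assoc,
    tensorHom_comp_tensorHom_assoc, id_tensorHom, comul_counit, id_tensorHom_id, Category.comp_id]
  simp only [tensorμ, braiding_tensorUnit_left, MonoidalCategory.tensorHom_def]
  monoidal

end Cartesian

/-! ### Linear forms -/

section Lin

open ComonObj
open scoped MonObj

universe v w

variable {C : Type w} [Category.{v} C] [MonoidalCategory C]

/-- The comonoid homomorphisms from `X` to `Q`; if `Q` is a commutative Hopf algebra, these form an
abelian group under convolution. -/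
@[ext]
structure Lin (X Q : C) [ComonObj X] [ComonObj Q] where
  /-- The underlying morphism. -/
  hom : X ⟶ Q
  isComonHom : IsComonHom hom

attribute [instance] Lin.isComonHom

variable [SymmetricCategory C]

attribute [local instance] ComonObj.instTensorUnit

variable {X Y Q : C} [ComonObj X] [IsCommComonObj X] [ComonObj Y] [IsCommComonObj Y] [ComonObj Q]
  [MonObj Q] [IsCommMonObj Q] [IsComonHom μ[Q]] [IsComonHom η[Q]]

namespace Lin

set_option linter.unusedSectionVars false

instance : Zero (Lin X Q) := ⟨⟨ε[X] ≫ η[Q], inferInstance⟩⟩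

instance : Add (Lin X Q) := ⟨fun f g => ⟨pair f.hom g.hom ≫ μ[Q], inferInstance⟩⟩

theorem zero_hom : (0 : Lin X Q).hom = ε[X] ≫ η[Q] := rfl

theorem add_hom (f g : Lin X Q) : (f + g).hom = pair f.hom g.hom ≫ μ[Q] := rfl

/-- A comonoid homomorphism as an element of the convolution monoid. -/
def toConv (f : Lin X Q) : Conv X Q := f.hom

theorem toConv_injective : Function.Injective (toConv : Lin X Q → Conv X Q) :=
  fun _ _ h => Lin.ext h

theorem toConv_zero : (0 : Lin X Q).toConv = 1 := rfl

theorem toConv_add (f g : Lin X Q) : (f + g).toConv = f.toConv * g.toConv := by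
  rw [Conv.mul_eq]
  change (Δ[X] ≫ (f.hom ⊗ₘ g.hom)) ≫ μ[Q] = Δ[X] ≫ f.hom ▷ X ≫ Q ◁ g.hom ≫ μ[Q]
  rw [MonoidalCategory.tensorHom_def, Category.assoc, Category.assoc]

instance : AddCommMonoid (Lin X Q) where
  nsmul := nsmulRec
  add_assoc f g h := toConv_injective (by simp only [toConv_add, mul_assoc])
  zero_add f := toConv_injective (by rw [toConv_add, toConv_zero, one_mul])
  add_zero f := toConv_injective (by rw [toConv_add, toConv_zero, mul_one])
  add_comm f g := Lin.ext (by
    rw [add_hom, add_hom, ← pair_comp_braiding f.hom, Category.assoc, IsCommMonObj.mul_comm])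

/-- Under the Hopf law with trivial antipode, the group of linear forms has exponent two. -/
theorem add_self (hopf : Δ[Q] ≫ μ[Q] = ε[Q] ≫ η[Q]) (f : Lin X Q) : f + f = 0 := by
  apply Lin.ext
  rw [add_hom, zero_hom, pair, ← IsComonHom.hom_comul, Category.assoc, hopf, ← Category.assoc,
    IsComonHom.hom_counit]

/-- Precomposition with a comonoid homomorphism. -/
def comap (h : X ⟶ Y) [IsComonHom h] : Lin Y Q →+ Lin X Q where
  toFun f := ⟨h ≫ f.hom, inferInstance⟩
  map_zero' := Lin.ext (by
    change h ≫ ε[Y] ≫ η[Q] = ε[X] ≫ η[Q]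
    rw [← Category.assoc, IsComonHom.hom_counit])
  map_add' f g := Lin.ext (by
    change h ≫ pair f.hom g.hom ≫ μ[Q] = pair (h ≫ f.hom) (h ≫ g.hom) ≫ μ[Q]
    rw [← Category.assoc, comp_pair])

@[simp] theorem comap_hom (h : X ⟶ Y) [IsComonHom h] (f : Lin Y Q) :
    (comap h f).hom = h ≫ f.hom := rfl

end Lin

end Lin

/-! ### Registers -/

open scoped ComonObj MonObj

attribute [local instance] ComonObj.instTensorUnit

/-- The register of `n` qubits; for `n = 0` the empty type, so that the rest of a register after
its first qubit is always defined. -/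
def R : ℕ → Ty
  | 0 => 𝟙_ Ty
  | n + 1 => ⟨[n + 1], by simp⟩

theorem one_regs_R (n : ℕ) : one (R n).regs = cls (reg n) := by
  cases n
  · rfl
  · exact (cls_wire _).symm

section Vals

variable {X Y Z W : Ty}

theorem val_comp_of_val_eq_one (e : X ⟶ Y) (f : Y ⟶ Z) (he : e.val = one X.regs)
    (h : X.regs = Y.regs) : Mor.val (e ≫ f) = f.val := by
  rw [val_comp, he, h, f.isHom.one_comp]

theorem comp_val_of_val_eq_one (f : X ⟶ Y) (e : Y ⟶ Z) (he : e.val = one Y.regs) :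
    Mor.val (f ≫ e) = f.val := by
  rw [val_comp, he, f.isHom.comp_one]

theorem val_tensorμ : Mor.val (tensorμ X Y Z W) =
    one X.regs * braid Y.regs Z.regs * one W.regs := by
  rw [tensorμ, val_comp_of_val_eq_one _ _ rfl (by simp),
    val_comp_of_val_eq_one _ _ (by simp [one_append]) (by simp), ← Category.assoc,
    comp_val_of_val_eq_one, comp_val_of_val_eq_one]
  · simp [mul_assoc]
  · simp [one_append]
  · simp [one_append]

end Vals

/-- Copying and erasing bit strings, by green spiders, make a register a comonoid. -/
instance comonObjR : ∀ n, ComonObj (R n)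
  | 0 => ComonObj.instTensorUnit Ty
  | n + 1 =>
    { counit := ⟨sp .green (n + 1) 1 0, isHom_sp n.succ_pos⟩
      comul := ⟨sp .green (n + 1) 1 2, isHom_sp n.succ_pos⟩
      counit_comul := hom_ext (sp_comp_left_counit n.succ_pos)
      comul_counit := hom_ext (by
        rw [val_rightUnitor_inv]
        exact (sp_comp_right_counit n.succ_pos 1).trans (sp_one_one n.succ_pos))
      comul_assoc := hom_ext (by
        rw [← Category.assoc, comp_val_of_val_eq_one _ (α_ _ _ _).hom rfl]
        exact (sp_one_two_comp_right n.succ_pos 2).trans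
          (sp_one_two_comp_left_one_two n.succ_pos).symm) }

theorem val_counit (n : ℕ) : Mor.val ε[R (n + 1)] = sp .green (n + 1) 1 0 := rfl

theorem val_comul (n : ℕ) : Mor.val Δ[R (n + 1)] = sp .green (n + 1) 1 2 := rfl

instance : ∀ n, IsCommComonObj (R n)
  | 0 => inferInstanceAs (IsCommComonObj (𝟙_ Ty))
  | n + 1 =>
    { comul_comm := hom_ext (by
        have h := braid_singleton_left n.succ_pos (pos_singleton n.succ_pos)
        rw [past_singleton n.succ_pos n.succ_pos] at h
        rw [val_comp, val_comul, val_braiding]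
        change _ ⊚ braid [n + 1] [n + 1] = _
        rw [h, sp_one_two_comp_swap n.succ_pos]) }

/-- Addition of bits is a monoid structure on a single qubit. The scalars `√2` and `1 / √2` make the
red spiders send basis states to basis states. -/
instance : MonObj (R 1) where
  mul := ⟨sqrtTwo * sp .red 1 2 1, isHom_sqrtTwo.mul (isHom_sp one_pos)⟩
  one := ⟨invSqrtTwo * sp .red 1 0 1, isHom_invSqrtTwo.mul (isHom_sp one_pos)⟩
  one_mul := hom_ext (by
    have p1 : ∀ k ∈ [1], 0 < k := by simp
    have r01 : IsHom (sp .red 1 0 1) [] [1] := isHom_sp one_pos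
    have r21 : IsHom (sp .red 1 2 1) [1, 1] [1] := isHom_sp one_pos
    have h := unit_comp_sp (c := .red) one_pos 1 1
    change (invSqrtTwo * sp .red 1 0 1 * one [1]) ⊚ (sqrtTwo * sp .red 1 2 1) = one [1]
    rw [mul_assoc, ← scalar_mul_comp isHom_invSqrtTwo (r01.mul (.one p1))
      (isHom_sqrtTwo.mul r21), ← scalar_mul_comp' isHom_sqrtTwo (r01.mul (.one p1)) r21,
      ← mul_assoc, invSqrtTwo_mul_sqrtTwo, one_mul]
    exact h.trans (sp_one_one one_pos))
  mul_one := hom_ext (by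
    have p1 : ∀ k ∈ [1], 0 < k := by simp
    have r01 : IsHom (sp .red 1 0 1) [] [1] := isHom_sp one_pos
    have r21 : IsHom (sp .red 1 2 1) [1, 1] [1] := isHom_sp one_pos
    have h := unit_comp_sp (c := .red) one_pos 1 1
    have hn := braid_natural p1 r01
    have e : (one [1] * sp .red 1 0 1) ⊚ sp .red 1 2 1 = one [1] := by
      have h2 := swap_comp_sp_two_one (c := .red) one_pos
      rw [← past_singleton one_pos one_pos, ← braid_singleton_left one_pos p1] at h2
      rw [← h2, ← DClass.comp_assoc, hn, braid_nil_right p1, DClass.comp_assoc]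
      refine Eq.trans (congrArg _ h) ?_
      rw [sp_one_one one_pos, (IsHom.one p1).one_comp]
    rw [val_rightUnitor_hom]
    change (one [1] * (invSqrtTwo * sp .red 1 0 1)) ⊚ (sqrtTwo * sp .red 1 2 1) = one [1]
    rw [← mul_assoc, ← scalar_mul_comm isHom_invSqrtTwo (.one p1), mul_assoc,
      ← scalar_mul_comp isHom_invSqrtTwo ((IsHom.one p1).mul r01)
      (isHom_sqrtTwo.mul r21), ← scalar_mul_comp' isHom_sqrtTwo ((IsHom.one p1).mul r01) r21,
      ← mul_assoc, invSqrtTwo_mul_sqrtTwo, one_mul, e])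
  mul_assoc := hom_ext (by
    have p1 : ∀ k ∈ [1], 0 < k := by simp
    have r21 : IsHom (sp .red 1 2 1) [1, 1] [1] := isHom_sp one_pos
    have i1 : IsHom (sp .red 1 2 1 * one [1]) [1, 1, 1] [1, 1] := r21.mul (.one p1)
    have i2 : IsHom (one [1] * sp .red 1 2 1) [1, 1, 1] [1, 1] := (IsHom.one p1).mul r21
    rw [val_comp_of_val_eq_one (α_ _ _ _).hom _ rfl (by simp)]
    change (sqrtTwo * sp .red 1 2 1 * one [1]) ⊚ (sqrtTwo * sp .red 1 2 1) =
      (one [1] * (sqrtTwo * sp .red 1 2 1)) ⊚ (sqrtTwo * sp .red 1 2 1)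
    rw [← mul_assoc (one [1]), ← scalar_mul_comm isHom_sqrtTwo (.one p1), mul_assoc, mul_assoc,
      ← scalar_mul_comp isHom_sqrtTwo i1 (isHom_sqrtTwo.mul r21),
      ← scalar_mul_comp isHom_sqrtTwo i2 (isHom_sqrtTwo.mul r21),
      ← scalar_mul_comp' isHom_sqrtTwo i1 r21, ← scalar_mul_comp' isHom_sqrtTwo i2 r21,
      sp_two_one_comp_left one_pos, sp_two_one_comp_right_two_one one_pos])

theorem val_mul : Mor.val μ[R 1] = sqrtTwo * sp .red 1 2 1 := rfl

theorem val_one : Mor.val η[R 1] = invSqrtTwo * sp .red 1 0 1 := rfl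

instance : IsCommMonObj (R 1) where
  mul_comm := hom_ext (by
    have r21 : IsHom (sp .red 1 2 1) [1, 1] [1] := isHom_sp one_pos
    have p1 : ∀ k ∈ [1], 0 < k := by simp
    rw [val_comp, val_braiding, val_mul]
    change braid [1] [1] ⊚ (sqrtTwo * sp .red 1 2 1) = sqrtTwo * sp .red 1 2 1
    rw [← scalar_mul_comp' isHom_sqrtTwo (isHom_braid p1 p1) r21, braid_singleton_left one_pos p1,
      past_singleton one_pos one_pos, swap_comp_sp_two_one one_pos])

instance : IsComonHom μ[R 1] where
  hom_counit := hom_ext (by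
    have r21 : IsHom (sp .red 1 2 1) [1, 1] [1] := isHom_sp one_pos
    have g10 : IsHom (sp .green 1 1 0) [1] [] := isHom_sp one_pos
    rw [Comon.tensorObj_counit, comp_val_of_val_eq_one _ (λ_ _).hom rfl]
    change (sqrtTwo * sp .red 1 2 1) ⊚ sp .green 1 1 0 = sp .green 1 1 0 * sp .green 1 1 0
    rw [← scalar_mul_comp isHom_sqrtTwo r21 g10, red_merge_counit])
  hom_comul := hom_ext (by
    have p1 : ∀ k ∈ [1], 0 < k := by simp
    have r21 : IsHom (sp .red 1 2 1) [1, 1] [1] := isHom_sp one_pos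
    have g12 : IsHom (sp .green 1 1 2) [1] [1, 1] := isHom_sp one_pos
    have hsw : IsHom (one [1] * cls (swap 1 1) * one [1]) [1, 1, 1, 1] [1, 1, 1, 1] :=
      ((IsHom.one p1).mul (isHom_swap one_pos one_pos)).mul (.one p1)
    have i : IsHom (sp .green 1 1 2 * sp .green 1 1 2) [1, 1] [1, 1, 1, 1] := g12.mul g12
    rw [Comon.tensorObj_comul, val_comp, val_comp, val_comp, val_tensorμ]
    change (sqrtTwo * sp .red 1 2 1) ⊚ sp .green 1 1 2 =
      (sp .green 1 1 2 * sp .green 1 1 2) ⊚ (one [1] * braid [1] [1] * one [1]) ⊚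
        ((sqrtTwo * sp .red 1 2 1) * (sqrtTwo * sp .red 1 2 1))
    rw [braid_singleton_left one_pos p1, past_singleton one_pos one_pos,
      ← scalar_mul_comp isHom_sqrtTwo r21 g12, red_green_bialgebra, mul_assoc sqrtTwo,
      ← mul_assoc (sp .red 1 2 1), ← scalar_mul_comm isHom_sqrtTwo r21, mul_assoc sqrtTwo,
      ← scalar_mul_comp' isHom_sqrtTwo (i.comp hsw) (isHom_sqrtTwo.mul (r21.mul r21)),
      ← scalar_mul_comp' isHom_sqrtTwo (i.comp hsw) (r21.mul r21)])

instance : IsComonHom η[R 1] where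
  hom_counit := hom_ext (by
    have r01 : IsHom (sp .red 1 0 1) [] [1] := isHom_sp one_pos
    have g10 : IsHom (sp .green 1 1 0) [1] [] := isHom_sp one_pos
    change (invSqrtTwo * sp .red 1 0 1) ⊚ sp .green 1 1 0 = one []
    rw [← scalar_mul_comp isHom_invSqrtTwo r01 g10, one_nil, ← invSqrtTwo_mul_sqrtTwo,
      ← bone_red]
    rfl)
  hom_comul := hom_ext (by
    have r01 : IsHom (sp .red 1 0 1) [] [1] := isHom_sp one_pos
    have g12 : IsHom (sp .green 1 1 2) [1] [1, 1] := isHom_sp one_pos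
    change (invSqrtTwo * sp .red 1 0 1) ⊚ sp .green 1 1 2 =
      one [] ⊚ ((invSqrtTwo * sp .red 1 0 1) * (invSqrtTwo * sp .red 1 0 1))
    rw [IsHom.one_comp (a := []) (b := [1, 1])
      ((isHom_invSqrtTwo.mul r01).mul (isHom_invSqrtTwo.mul r01)),
      mul_assoc, ← mul_assoc (sp .red 1 0 1), ← scalar_mul_comm isHom_invSqrtTwo r01, mul_assoc,
      ← red_unit_copy, ← mul_assoc invSqrtTwo sqrtTwo, invSqrtTwo_mul_sqrtTwo, one_mul,
      scalar_mul_comp isHom_invSqrtTwo r01 g12])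

/-- Adding a bit to its copy gives zero. -/
theorem comul_comp_mul : Δ[R 1] ≫ μ[R 1] = ε[R 1] ≫ η[R 1] := hom_ext (by
  have r21 : IsHom (sp .red 1 2 1) [1, 1] [1] := isHom_sp one_pos
  have r01 : IsHom (sp .red 1 0 1) [] [1] := isHom_sp one_pos
  have g12 : IsHom (sp .green 1 1 2) [1] [1, 1] := isHom_sp one_pos
  have g10 : IsHom (sp .green 1 1 0) [1] [] := isHom_sp one_pos
  change sp .green 1 1 2 ⊚ (sqrtTwo * sp .red 1 2 1) =
    sp .green 1 1 0 ⊚ (invSqrtTwo * sp .red 1 0 1)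
  rw [← scalar_mul_comp' isHom_sqrtTwo g12 r21, ← scalar_mul_comp' isHom_invSqrtTwo g10 r01,
    hopf_law])

theorem isHom_divider (n : ℕ) : IsHom (cls (divider n)) [n + 1] ([1] ++ (R n).regs) := by
  cases n
  · exact ⟨wire 1, one_pos, rfl, rfl, rfl⟩
  · exact ⟨Diag.div _, Nat.succ_pos _, rfl, rfl, rfl⟩

theorem isHom_gatherer (n : ℕ) : IsHom (cls (gatherer n)) ([1] ++ (R n).regs) [n + 1] := by
  cases n
  · exact ⟨wire 1, one_pos, rfl, rfl, rfl⟩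
  · exact ⟨Diag.gath _, Nat.succ_pos _, rfl, rfl, rfl⟩

/-- The first qubit of a register is split off by the divider. -/
def splitFirst (n : ℕ) : R (n + 1) ≅ R 1 ⊗ R n where
  hom := ⟨cls (divider n), isHom_divider n⟩
  inv := ⟨cls (gatherer n), isHom_gatherer n⟩
  hom_inv_id := hom_ext (by
    rw [val_comp, val_id]
    change cls (divider n) ⊚ cls (gatherer n) = one [n + 1]
    cases n with
    | zero =>
      rw [divider, gatherer, cls_wire, (IsHom.one (a := [1]) (by simp)).comp_one]
    | succ n =>
      rw [← cls_wire]
      exact cls_rule (.expand (n + 1)) ⟨⟨n.succ_pos, n.succ_pos, rfl⟩, Nat.succ_pos _, rfl, rfl⟩)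
  inv_hom_id := hom_ext (by
    rw [val_comp, val_id, regs_tensor, one_append, one_regs_R, one_regs_R]
    change cls (gatherer n) ⊚ cls (divider n) = _
    cases n with
    | zero =>
      rw [divider, gatherer, cls_wire, (IsHom.one (a := [1]) (by simp)).comp_one, reg, reg,
        cls_wire]
      exact (mul_one _).symm
    | succ n =>
      exact cls_rule (.elim (n + 1)) ⟨⟨n.succ_pos, n.succ_pos, rfl⟩, ⟨one_pos, n.succ_pos⟩, rfl,
        rfl⟩)

theorem val_splitFirst_hom (n : ℕ) : Mor.val (splitFirst n).hom = cls (divider n) := rfl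

theorem val_splitFirst_inv (n : ℕ) : Mor.val (splitFirst n).inv = cls (gatherer n) := rfl

instance isComonHom_splitFirst_hom (n : ℕ) : IsComonHom (splitFirst n).hom := by
  cases n with
  | zero =>
    have h : (splitFirst 0).hom = (ρ_ (R 1)).symm.hom := hom_ext (by
      rw [val_splitFirst_hom, divider, cls_wire, Iso.symm_hom, val_rightUnitor_inv]
      rfl)
    have := isComonHom_rightUnitor (Y := R 1)
    rw [h]
    exact inferInstanceAs (IsComonHom (ρ_ (R 1)).inv)
  | succ n =>
    refine isComonHom_of_iso _ (hom_ext ?_)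
    have h : sp .green (n + 2) 1 2 ⊚ (cls (Diag.div (n + 1)) * cls (Diag.div (n + 1))) =
        cls (Diag.div (n + 1)) ⊚ (sp .green 1 1 2 * sp .green (n + 1) 1 2) ⊚
          (one [1] * cls (swap 1 (n + 1)) * one [n + 1]) := by
      rw [← cls_wire, ← cls_wire]
      exact cls_rule (.copy_div .green (n + 1))
        (by simp [WellTyped, spider₀, dom, cod, List.replicate_succ])
    rw [Comon.tensorObj_comul, val_comp, val_comp, val_comp, val_tensorμ]
    change cls (Diag.div (n + 1)) ⊚ ((sp .green 1 1 2 * sp .green (n + 1) 1 2) ⊚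
      (one [1] * braid [1] [n + 1] * one [n + 1])) =
        sp .green (n + 2) 1 2 ⊚ (cls (Diag.div (n + 1)) * cls (Diag.div (n + 1)))
    rw [h, braid_singleton_left one_pos (pos_singleton n.succ_pos),
      past_singleton one_pos n.succ_pos, DClass.comp_assoc]

/-- The uniform superposition of all bit strings, unnormalised. -/
def unif : ∀ n, 𝟙_ Ty ⟶ R n
  | 0 => 𝟙 _
  | n + 1 => ⟨sp .green (n + 1) 0 1, isHom_sp n.succ_pos⟩

theorem unif_comp_splitFirst (n : ℕ) :
    unif (n + 1) ≫ (splitFirst n).hom = (λ_ (𝟙_ Ty)).inv ≫ (unif 1 ⊗ₘ unif n) := hom_ext (by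
  have g01 : IsHom (sp .green 1 0 1) [] [1] := isHom_sp one_pos
  rw [val_comp_of_val_eq_one (λ_ _).inv _ rfl rfl, val_tensorHom]
  cases n with
  | zero =>
    change sp .green 1 0 1 ⊚ cls (wire 1) = sp .green 1 0 1 * 1
    rw [cls_wire, g01.comp_one, mul_one]
  | succ n =>
    have h : cls (spider .green (n + 1 + 1) 0 1 (Fin.cons 0 0) ⨟ Diag.div (n + 1)) =
        sp .green 1 0 1 * sp .green (n + 1) 0 1 :=
      cls_rule (.unit_div .green (n + 1) 0 0)
        (by simp [WellTyped, spider₀, dom, cod])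
    rwa [show (Fin.cons 0 0 : Fin (n + 1 + 1) → ℝ) = 0 from Matrix.cons_zero_zero] at h)

theorem unif_comp_comul (n : ℕ) : Mor.val (unif (n + 1) ≫ Δ[R (n + 1)]) = sp .green (n + 1) 0 2 :=
  sp_zero_one_comp n.succ_pos 2

/-- Adding a uniformly distributed bit discards the other summand. -/
theorem unif_add : R 1 ◁ unif 1 ≫ μ[R 1] = (ρ_ (R 1)).hom ≫ ε[R 1] ≫ unif 1 := hom_ext (by
  have p1 : ∀ k ∈ [1], 0 < k := by simp
  have r21 : IsHom (sp .red 1 2 1) [1, 1] [1] := isHom_sp one_pos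
  have g01 : IsHom (sp .green 1 0 1) [] [1] := isHom_sp one_pos
  have g10 : IsHom (sp .green 1 1 0) [1] [] := isHom_sp one_pos
  rw [val_comp_of_val_eq_one (ρ_ _).hom _ (by simp) (by simp)]
  change (one [1] * sp .green 1 0 1) ⊚ (sqrtTwo * sp .red 1 2 1) =
    sp .green 1 1 0 ⊚ sp .green 1 0 1
  have h := g10.mul_one_comp_one_mul g01
  rw [one_nil, one_mul, mul_one] at h
  rw [← scalar_mul_comp' isHom_sqrtTwo ((IsHom.one p1).mul g01) r21, green_unit_add, h])

/-- The Hadamard box. -/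
def hadamard : ∀ n, R n ⟶ R n
  | 0 => 𝟙 _
  | n + 1 => ⟨cls (had (n + 1)), .of_cls (f := had (n + 1)) n.succ_pos⟩

theorem hadamard_comp_hadamard : hadamard 1 ≫ hadamard 1 = 𝟙 (R 1) :=
  hom_ext (had_comp_had one_pos)

theorem hadamard_comp_splitFirst (n : ℕ) : hadamard (n + 1) ≫ (splitFirst n).hom =
    (splitFirst n).hom ≫ (hadamard 1 ⊗ₘ hadamard n) := hom_ext (by
  rw [val_comp, val_comp, val_tensorHom]
  have hh : IsHom (cls (had 1)) [1] [1] := .of_cls (f := had 1) one_pos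
  cases n with
  | zero =>
    change cls (had 1) ⊚ cls (wire 1) = cls (wire 1) ⊚ (cls (had 1) * 1)
    rw [cls_wire, mul_one, hh.comp_one, hh.one_comp]
  | succ n =>
    exact cls_rule (.had_div (n + 1)) (by simp [WellTyped, divider, dom, cod]))

/-! ### Matrices in coordinates -/

section

variable {X Y : Ty} [ComonObj X] [IsCommComonObj X] [ComonObj Y] [IsCommComonObj Y]

/-- By the Hopf law, every linear form is its own negative. -/
instance : Neg (Lin X (R 1)) := ⟨fun f => f⟩

instance : AddCommGroup (Lin X (R 1)) where
  zsmul := zsmulRec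
  neg_add_cancel f := Lin.add_self comul_comp_mul f
  add_comm := add_comm

instance : Module (ZMod 2) (Lin X (R 1)) :=
  AddCommGroup.zmodModule fun f => by rw [two_nsmul, Lin.add_self comul_comp_mul]

end

/-- The coordinates of a register: the value of one qubit, all others being discarded. -/
def coord : ∀ n, Fin n → Lin (R n) (R 1)
  | 0 => Fin.elim0
  | n + 1 => Fin.cases ⟨(splitFirst n).hom ≫ pfst (R 1) (R n), inferInstance⟩
      fun i => Lin.comap ((splitFirst n).hom ≫ psnd (R 1) (R n)) (coord n i)

theorem coord_zero (n : ℕ) :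
    (coord (n + 1) 0).hom = (splitFirst n).hom ≫ pfst (R 1) (R n) := rfl

theorem coord_succ (n : ℕ) (i : Fin n) : coord (n + 1) i.succ =
    Lin.comap ((splitFirst n).hom ≫ psnd (R 1) (R n)) (coord n i) := rfl

theorem coord_one : (coord 1 0).hom = 𝟙 (R 1) := hom_ext (by
  have h : Mor.val (pfst (R 1) (R 0)) = one [1] := by
    rw [pfst, comp_val_of_val_eq_one _ _ val_rightUnitor_hom]
    exact mul_one _
  exact (val_comp_of_val_eq_one (Y := R 1 ⊗ R 0) (splitFirst 0).hom (pfst (R 1) (R 0))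
    (cls_wire 1) rfl).trans h)

/-- Comonoid homomorphisms into a register are determined by their coordinates. -/
theorem eq_of_comp_coord {X : Ty} [ComonObj X] {n : ℕ} (f g : X ⟶ R n) [IsComonHom f]
    [IsComonHom g] (h : ∀ i, f ≫ (coord n i).hom = g ≫ (coord n i).hom) : f = g := by
  induction n with
  | zero =>
    have hf : f = ε[X] := (Category.comp_id f).symm.trans (IsComonHom.hom_counit f)
    have hg : g = ε[X] := (Category.comp_id g).symm.trans (IsComonHom.hom_counit g)
    rw [hf, hg]
  | succ n ih =>
    have h0 := h 0
    rw [coord_zero, ← Category.assoc, ← Category.assoc] at h0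
    have h1 : (f ≫ (splitFirst n).hom) ≫ psnd _ _ = (g ≫ (splitFirst n).hom) ≫ psnd _ _ :=
      ih _ _ fun i => by
        have := h i.succ
        rw [coord_succ, Lin.comap_hom] at this
        simpa only [Category.assoc] using this
    rw [← cancel_mono (splitFirst n).hom, eq_pair (f ≫ (splitFirst n).hom), h0, h1, ← eq_pair]

section

variable {m n : ℕ}

/-- The matrix box. -/
def matBox (A : Matrix (Fin (m + 1)) (Fin (n + 1)) (ZMod 2)) : R (n + 1) ⟶ R (m + 1) :=
  ⟨cls (mat (m + 1) (n + 1) A), .of_cls (f := mat (m + 1) (n + 1) A) ⟨m.succ_pos, n.succ_pos⟩⟩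

theorem val_matBox (A : Matrix (Fin (m + 1)) (Fin (n + 1)) (ZMod 2)) :
    Mor.val (matBox A) = cls (mat (m + 1) (n + 1) A) := rfl

theorem mat_cast {m m' n n' : ℕ} (hm : m = m') (hn : n = n')
    (A : Matrix (Fin m') (Fin n') (ZMod 2)) :
    mat m n (A.submatrix (Fin.cast hm) (Fin.cast hn)) = mat m' n' A := by
  subst hm hn
  rfl

theorem matBox_zero : matBox (0 : Matrix (Fin 1) (Fin 1) (ZMod 2)) = ε[R 1] ≫ η[R 1] :=
  hom_ext (by
    have r01 : IsHom (sp .red 1 0 1) [] [1] := isHom_sp one_pos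
    have g10 : IsHom (sp .green 1 1 0) [1] [] := isHom_sp one_pos
    rw [val_comp, val_counit, val_one, ← scalar_mul_comp' isHom_invSqrtTwo g10 r01]
    exact cls_rule .mat_zero (by simp [WellTyped, tribone, spider₀, dom, cod]))

theorem matBox_one : matBox (1 : Matrix (Fin 1) (Fin 1) (ZMod 2)) = 𝟙 (R 1) :=
  hom_ext (by
    refine Eq.trans ?_ (cls_wire 1)
    exact cls_rule .mat_one (by simp [WellTyped, dom, cod]))

theorem matBox_rows (A : Matrix (Fin (m + 2)) (Fin (n + 1)) (ZMod 2)) :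
    matBox A = pair (matBox (m := 0) (Matrix.of fun _ j => A 0 j))
      (matBox (Matrix.of fun i j => A i.succ j)) ≫ (splitFirst (m + 1)).inv := hom_ext (by
  have e : mat (m + 2) (n + 1) A = mat (1 + (m + 1)) (n + 1)
      (vstack (Matrix.of fun _ j => A 0 j) (Matrix.of fun i j => A i.succ j)) := by
    rw [← mat_cast (Nat.add_comm (m + 1) 1) rfl]
    congr 1
    ext i j
    refine Fin.cases ?_ (fun i => ?_) i
    · have h0 : Fin.cast (Nat.add_comm (m + 1) 1) 0 = Fin.castAdd (m + 1) (0 : Fin 1) := rfl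
      rw [Matrix.submatrix_apply, h0]
      simp [vstack]
    · have hi : Fin.cast (Nat.add_comm (m + 1) 1) i.succ = Fin.natAdd 1 i :=
        Fin.ext (Nat.add_comm _ _)
      simp [vstack, hi]
  have h : cls (ggath 1 (m + 1)) = cls (gatherer (m + 1)) := by
    have p2 : ∀ k ∈ [1, m + 1], 0 < k := by simp
    have hg : IsHom (cls (gatherer (m + 1))) [1, m + 1] [m + 2] := isHom_gatherer (m + 1)
    change (cls (wire 1) * cls (wire (m + 1))) ⊚ (cls (wire 1) * cls (wire (m + 1))) ⊚
      cls (gatherer (0 + (m + 1))) = _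
    rw [cls_wire, cls_wire, ← one_append, Nat.zero_add]
    exact (congrArg (· ⊚ cls (gatherer (m + 1))) (IsHom.one p2).comp_one).trans hg.one_comp
  rw [val_matBox, e, pair, val_comp, val_comp, val_splitFirst_inv, ← h]
  exact cls_rule (.mat_rows 1 (m + 1) (n + 1) _ _)
    (by simp [WellTyped, spider₀, ggath, divider, gatherer, reg, dom, cod, List.replicate_succ,
      Nat.add_comm]))

theorem matBox_cols (A : Matrix (Fin 1) (Fin (n + 2)) (ZMod 2)) :
    matBox A = (splitFirst (n + 1)).hom ≫ (matBox (n := 0) (Matrix.of fun i _ => A i 0) ⊗ₘ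
      matBox (Matrix.of fun i j => A i j.succ)) ≫ μ[R 1] := hom_ext (by
  have e : mat 1 (n + 2) A = mat 1 (1 + (n + 1))
      (hstack (Matrix.of fun i _ => A i 0) (Matrix.of fun i j => A i j.succ)) := by
    rw [← mat_cast rfl (Nat.add_comm (n + 1) 1)]
    congr 1
    ext i j
    refine Fin.cases ?_ (fun j => ?_) j
    · have h0 : Fin.cast (Nat.add_comm (n + 1) 1) 0 = Fin.castAdd (n + 1) (0 : Fin 1) := rfl
      rw [Matrix.submatrix_apply, h0]
      simp [hstack]
    · have hj : Fin.cast (Nat.add_comm (n + 1) 1) j.succ = Fin.natAdd 1 j :=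
        Fin.ext (Nat.add_comm _ _)
      simp [hstack, hj]
  have hg : IsHom (cls (divider (n + 1))) [n + 2] [1, n + 1] := isHom_divider (n + 1)
  have h : cls (gdiv 1 (n + 1)) = cls (divider (n + 1)) := by
    have p2 : ∀ k ∈ [1, n + 1], 0 < k := by simp
    change cls (divider (0 + (n + 1))) ⊚ (cls (wire 1) * cls (wire (n + 1))) ⊚
      (cls (wire 1) * cls (wire (n + 1))) = _
    rw [cls_wire, cls_wire, ← one_append, Nat.zero_add]
    exact (congrArg (· ⊚ one [1, n + 1]) hg.comp_one).trans hg.comp_one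
  have r21 : IsHom (sp .red 1 2 1) [1, 1] [1] := isHom_sp one_pos
  rw [val_matBox, e, ← Category.assoc, val_comp _ μ[R 1], val_mul, ← scalar_mul_comp' isHom_sqrtTwo
    ((splitFirst (n + 1)).hom ≫ (matBox (n := 0) (Matrix.of fun i _ => A i 0) ⊗ₘ
      matBox (Matrix.of fun i j => A i j.succ))).isHom r21, val_comp, val_splitFirst_hom, ← h]
  exact cls_rule (.mat_cols 1 1 (n + 1) _ _)
    (by simp [WellTyped, bone, spider₀, gdiv, divider, gatherer, reg, dom, cod, List.replicate_succ,
      Nat.add_comm]))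

theorem matBox_entry (A : Matrix (Fin 1) (Fin 1) (ZMod 2)) :
    matBox A = (A 0 0 • coord 1 0).hom := by
  obtain h | h : A 0 0 = 0 ∨ A 0 0 = 1 := by
    generalize A 0 0 = a
    revert a
    decide
  · have hA : A = 0 := by
      ext i j
      rw [Subsingleton.elim i 0, Subsingleton.elim j 0, h]
      rfl
    rw [h, zero_smul, Lin.zero_hom, hA, matBox_zero]
  · have hA : A = 1 := by
      ext i j
      rw [Subsingleton.elim i 0, Subsingleton.elim j 0, h]
      rfl
    rw [h, one_smul, coord_one, hA, matBox_one]

theorem splitFirst_comp_tensorHom_comp_mul (f : Lin (R 1) (R 1)) (g : Lin (R n) (R 1)) :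
    (splitFirst n).hom ≫ (f.hom ⊗ₘ g.hom) ≫ μ[R 1] =
      (Lin.comap ((splitFirst n).hom ≫ pfst (R 1) (R n)) f +
        Lin.comap ((splitFirst n).hom ≫ psnd (R 1) (R n)) g).hom := by
  rw [Lin.add_hom, Lin.comap_hom, Lin.comap_hom, ← pair_comp_tensorHom, ← comp_pair,
    pair_pfst_psnd, Category.comp_id, Category.assoc]

theorem matBox_row (A : Matrix (Fin 1) (Fin (n + 1)) (ZMod 2)) :
    matBox A = (∑ j, A 0 j • coord (n + 1) j).hom := by
  induction n with
  | zero => rw [Fin.sum_univ_one, matBox_entry]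
  | succ n ih =>
    have h0 : Lin.comap ((splitFirst (n + 1)).hom ≫ pfst (R 1) (R (n + 1))) (coord 1 0) =
        coord (n + 2) 0 := Lin.ext (by
      rw [Lin.comap_hom, coord_one, Category.comp_id, coord_zero])
    rw [matBox_cols, ih, matBox_entry, splitFirst_comp_tensorHom_comp_mul, ZMod.map_smul, h0,
      map_sum, Fin.sum_univ_succ (n := n + 1)]
    simp only [ZMod.map_smul, ← coord_succ]
    rfl

/-- A matrix box is a comonoid homomorphism. -/
instance isComonHom_matBox (A : Matrix (Fin (m + 1)) (Fin (n + 1)) (ZMod 2)) :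
    IsComonHom (matBox A) := by
  induction m with
  | zero =>
    rw [matBox_row]
    infer_instance
  | succ m ih =>
    have h1 := ih (Matrix.of fun i j => A i.succ j)
    have h2 : IsComonHom (matBox (m := 0) (Matrix.of fun _ j => A 0 j)) := by
      rw [matBox_row]
      infer_instance
    rw [matBox_rows]
    infer_instance

/-- A matrix box acts on coordinates as the matrix. -/
theorem matBox_comp_coord (A : Matrix (Fin (m + 1)) (Fin (n + 1)) (ZMod 2)) (i : Fin (m + 1)) :
    matBox A ≫ (coord (m + 1) i).hom = (∑ j, A i j • coord (n + 1) j).hom := by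
  induction m with
  | zero =>
    rw [Subsingleton.elim (α := Fin 1) i 0, ← matBox_row]
    exact (congrArg (matBox A ≫ ·) coord_one).trans (Category.comp_id _)
  | succ m ih =>
    rw [matBox_rows]
    refine Fin.cases ?_ (fun i => ?_) i
    · rw [coord_zero, Category.assoc, Iso.inv_hom_id_assoc, pair_pfst, matBox_row]
      rfl
    · rw [coord_succ, Lin.comap_hom, Category.assoc, Category.assoc, Iso.inv_hom_id_assoc,
        ← Category.assoc, pair_psnd, ih]
      rfl

end

/-! ### Changing variables in a uniform superposition -/

/-- The first qubit of a register. -/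
def headQubit (n : ℕ) : R (n + 1) ⟶ R 1 := (splitFirst n).hom ≫ pfst (R 1) (R n)

/-- The remaining qubits of a register. -/
def tailQubits (n : ℕ) : R (n + 1) ⟶ R n := (splitFirst n).hom ≫ psnd (R 1) (R n)

instance (n : ℕ) : IsComonHom (tailQubits n) := by
  rw [tailQubits]
  infer_instance

theorem splitFirst_eq_pair (n : ℕ) : (splitFirst n).hom = pair (headQubit n) (tailQubits n) :=
  eq_pair _

theorem coord_zero_eq (n : ℕ) : (coord (n + 1) 0).hom = headQubit n := rfl

theorem coord_succ_eq (n : ℕ) (i : Fin n) :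
    coord (n + 1) i.succ = Lin.comap (tailQubits n) (coord n i) := rfl

theorem unif_add_left : unif 1 ▷ R 1 ≫ μ[R 1] = (λ_ (R 1)).hom ≫ ε[R 1] ≫ unif 1 := by
  rw [← IsCommMonObj.mul_comm (R 1), BraidedCategory.braiding_naturality_left_assoc, unif_add,
    braiding_tensorUnit_left, Category.assoc, Iso.inv_hom_id_assoc]

variable {n : ℕ}

/-- Replacement of the first qubit by a linear form `f`, the others being kept. It is a shear if `f`
is the sum of the first coordinate and a form in the others. -/
def shear (f : Lin (R (n + 1)) (R 1)) : R (n + 1) ⟶ R (n + 1) :=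
  pair f.hom (tailQubits n) ≫ (splitFirst n).inv

instance (f : Lin (R (n + 1)) (R 1)) : IsComonHom (shear f) := by
  rw [shear]
  infer_instance

/-- A shear permutes the bit strings, and so preserves their uniform superposition. -/
theorem unif_comp_shear (a : Lin (R n) (R 1)) :
    unif (n + 1) ≫ shear (coord (n + 1) 0 + Lin.comap (tailQubits n) a) = unif (n + 1) := by
  set h := R 1 ◁ a.hom ≫ μ[R 1] with hh
  have e1 : pair (coord (n + 1) 0 + Lin.comap (tailQubits n) a).hom (tailQubits n) =
      (splitFirst n).hom ≫ pair h (psnd _ _) := by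
    have e2 : h = pair (pfst (R 1) (R n)) (psnd (R 1) (R n) ≫ a.hom) ≫ μ[R 1] := by
      rw [hh, ← Category.comp_id (pfst (R 1) (R n)), ← pair_comp_tensorHom, pair_pfst_psnd,
        Category.id_comp, id_tensorHom]
    rw [comp_pair, e2, ← Category.assoc, comp_pair, Lin.add_hom, coord_zero_eq, Lin.comap_hom,
      tailQubits, headQubit, Category.assoc]
  -- the first bit is uniform and independent of the rest, and so remains after the addition
  have e3 : unif 1 ▷ R n ≫ h = (λ_ (R n)).hom ≫ ε[R n] ≫ unif 1 := by
    rw [hh, ← whisker_exchange_assoc, unif_add_left, leftUnitor_naturality_assoc,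
      ← Category.assoc a.hom, IsComonHom.hom_counit]
  have e4 : (unif 1 ⊗ₘ unif n) ≫ pair h (psnd _ _) = unif 1 ⊗ₘ unif n := by
    rw [pair_psnd_eq, MonoidalCategory.tensorHom_def', Category.assoc, ← whisker_exchange_assoc,
      associator_inv_naturality_left_assoc, ← comp_whiskerRight, e3]
    simp only [comp_whiskerRight, leftUnitor_whiskerRight, Category.assoc,
      Iso.inv_hom_id_assoc, leftUnitor_naturality_assoc, ComonObj.counit_comul_assoc]
    simp
  rw [shear, e1, Category.assoc, ← Category.assoc (unif _), unif_comp_splitFirst, Category.assoc,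
    ← Category.assoc (_ ⊗ₘ _), e4, ← Category.assoc, ← unif_comp_splitFirst, Category.assoc,
    Iso.hom_inv_id, Category.comp_id]

/-! ### Pivoting -/

section

variable {p q : ℕ}

/-- The graph state of a bipartite graph as a morphism, without its normalising scalar, and with the
first qubits of the two registers brought to the front: the first column, the first row, the other
columns, the other rows. -/
def graphState (Γ : Matrix (Fin (q + 1)) (Fin (p + 1)) (ZMod 2)) :
    𝟙_ Ty ⟶ (R 1 ⊗ R 1) ⊗ (R p ⊗ R q) :=
  unif (p + 1) ≫ pair (𝟙 _) (matBox Γ ≫ hadamard (q + 1)) ≫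
    ((splitFirst p).hom ⊗ₘ (splitFirst q).hom) ≫ tensorμ _ _ _ _

/-- The Hadamard boxes act on the rows, after the linear part. -/
theorem graphState_eq (Γ : Matrix (Fin (q + 1)) (Fin (p + 1)) (ZMod 2)) :
    graphState Γ = unif (p + 1) ≫ pair (pair (headQubit p) (matBox Γ ≫ headQubit q))
      (pair (tailQubits p) (matBox Γ ≫ tailQubits q)) ≫
        ((𝟙 _ ⊗ₘ hadamard 1) ⊗ₘ (𝟙 _ ⊗ₘ hadamard q)) := by
  have e : pair (𝟙 _) (matBox Γ ≫ hadamard (q + 1)) ≫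
      ((splitFirst p).hom ⊗ₘ (splitFirst q).hom) =
      pair (pair (headQubit p) (tailQubits p))
        (pair (matBox Γ ≫ headQubit q ≫ hadamard 1) (matBox Γ ≫ tailQubits q ≫ hadamard q)) := by
    rw [pair_comp_tensorHom, Category.id_comp, Category.assoc, hadamard_comp_splitFirst,
      splitFirst_eq_pair, splitFirst_eq_pair q, pair_comp_tensorHom, comp_pair]
  rw [graphState, reassoc_of% e, pair_pair_tensorμ, pair_comp_tensorHom, pair_comp_tensorHom,
    pair_comp_tensorHom]
  simp only [Category.comp_id, Category.assoc]

/-- Pivoting, in the category of diagrams: the two superpositions differ by a shear of the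
variables. -/
theorem graphState_pivot {Γ Γ' : Matrix (Fin (q + 1)) (Fin (p + 1)) (ZMod 2)} (h00 : Γ 0 0 = 1)
    (h00' : Γ' 0 0 = 1) (h0 : ∀ j : Fin p, Γ' 0 j.succ = Γ 0 j.succ)
    (h1 : ∀ i : Fin q, Γ' i.succ 0 = Γ i.succ 0)
    (h2 : ∀ (i : Fin q) (j : Fin p),
      Γ' i.succ j.succ = Γ i.succ j.succ + Γ i.succ 0 * Γ 0 j.succ) :
    graphState Γ ≫ ((hadamard 1 ⊗ₘ hadamard 1) ⊗ₘ 𝟙 _) = graphState Γ' ≫ ((β_ _ _).hom ▷ _) := by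
  set a : Lin (R p) (R 1) := ∑ j, Γ 0 j.succ • coord p j with ha
  set f : Lin (R (p + 1)) (R 1) := coord (p + 1) 0 + Lin.comap (tailQubits p) a with hf
  have ha' : Lin.comap (tailQubits p) a = ∑ j : Fin p, Γ 0 j.succ • coord (p + 1) j.succ := by
    rw [ha, map_sum]
    simp only [ZMod.map_smul, ← coord_succ_eq]
  have s0 : Lin.comap (shear f) (coord (p + 1) 0) = f := Lin.ext (by
    rw [Lin.comap_hom, coord_zero, shear, Category.assoc, Iso.inv_hom_id_assoc, pair_pfst])
  have st : shear f ≫ tailQubits p = tailQubits p := by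
    conv_lhs => rw [tailQubits, shear, Category.assoc, Iso.inv_hom_id_assoc, pair_psnd]
  have s1 (j : Fin p) : Lin.comap (shear f) (coord (p + 1) j.succ) = coord (p + 1) j.succ :=
    Lin.ext (by
      rw [Lin.comap_hom, coord_succ_eq, Lin.comap_hom, ← Category.assoc, st])
  have hrow (i : Fin (q + 1)) : shear f ≫ matBox Γ ≫ (coord (q + 1) i).hom =
      (Γ i 0 • f + ∑ j : Fin p, Γ i j.succ • coord (p + 1) j.succ).hom := by
    rw [matBox_comp_coord, ← Lin.comap_hom, map_sum, Fin.sum_univ_succ]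
    simp only [ZMod.map_smul, s0, s1]
  have key0 : shear f ≫ headQubit p = matBox Γ' ≫ headQubit q := by
    rw [← coord_zero_eq, ← coord_zero_eq, ← Lin.comap_hom, s0, matBox_comp_coord,
      Fin.sum_univ_succ, hf, ha', h00', one_smul]
    simp only [h0]
  have key1 : shear f ≫ matBox Γ ≫ headQubit q = headQubit p := by
    rw [← coord_zero_eq, ← coord_zero_eq, hrow, h00, one_smul, hf, ha', add_assoc,
      Lin.add_self comul_comp_mul, add_zero]
  have key2 : shear f ≫ matBox Γ ≫ tailQubits q = matBox Γ' ≫ tailQubits q := by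
    refine eq_of_comp_coord _ _ fun i => ?_
    have e := hrow i.succ
    have e' := matBox_comp_coord Γ' i.succ
    rw [coord_succ_eq, Lin.comap_hom] at e e'
    simp only [Category.assoc]
    rw [e, e', Fin.sum_univ_succ, h1, hf, ha']
    congr 1
    simp only [h2, add_smul, smul_add, Finset.sum_add_distrib, Finset.smul_sum, mul_smul]
    abel
  have hinv := unif_comp_shear a
  rw [← hf] at hinv
  have e : shear f ≫ pair (pair (headQubit p) (matBox Γ ≫ headQubit q))
      (pair (tailQubits p) (matBox Γ ≫ tailQubits q)) =
      pair (pair (matBox Γ' ≫ headQubit q) (headQubit p))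
        (pair (tailQubits p) (matBox Γ' ≫ tailQubits q)) := by
    rw [comp_pair, comp_pair, comp_pair, key0, key1, st, key2]
  rw [graphState_eq, graphState_eq]
  conv_lhs => rw [← hinv]
  simp only [Category.assoc, reassoc_of% e, ← tensorHom_id]
  congr 1
  simp only [← Category.assoc, pair_comp_tensorHom, pair_comp_braiding, Category.comp_id]
  simp only [Category.assoc, hadamard_comp_hadamard, Category.comp_id]

end

/-! ### Graph-state diagrams -/

theorem wellTyped_of_isHom_cls {f : Diag} {a b : List ℕ} (h : IsHom (cls f) a b) :
    f.WellTyped := by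
  obtain ⟨g, hg, -, -, e⟩ := h
  exact (provable_of_cls_eq hg e).wellTyped.2.1

theorem cls_restSwap (p : ℕ) : cls (restSwap p) = braid (R p).regs [1] := by
  cases p with
  | zero => exact cls_wire 1
  | succ p =>
    change _ = braid [p + 1] [1]
    rw [braid_singleton_left p.succ_pos (by simp), past_singleton p.succ_pos one_pos]
    rfl

theorem bipartiteGraphState_cast {m m' n n' : ℕ} (hm : m = m') (hn : n = n')
    (Γ : Matrix (Fin m') (Fin n') (ZMod 2)) :
    bipartiteGraphState m n (Γ.submatrix (Fin.cast hm) (Fin.cast hn)) =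
      bipartiteGraphState m' n' Γ := by
  subst hm hn
  rfl

theorem isHom_tribone (n : ℕ) : IsHom (cls (tribone .green (n + 1))) [] [] :=
  .of_cls (f := tribone .green (n + 1)) ⟨n.succ_pos, n.succ_pos, rfl⟩

/-- A graph-state diagram that is divided and followed by `f`, as a morphism: the normalising scalar
is the same for all graphs with the same number of columns. -/
theorem cls_bipartiteGraphState {p q : ℕ} (Γ : Matrix (Fin (q + 1)) (Fin (p + 1)) (ZMod 2))
    {f : Diag} {X : Ty} (x : (R 1 ⊗ R 1) ⊗ (R p ⊗ R q) ⟶ X) (hx : x.val = cls f) :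
    cls (bipartiteGraphState (q + 1) (p + 1) Γ ⨟ firstQubits p q ⨟ f) =
      cls (tribone .green (p + 1)) * Mor.val (graphState Γ ≫ x) := by
  set s := cls (tribone .green (p + 1)) with hs
  set g : 𝟙_ Ty ⟶ R (p + 1) ⊗ R (q + 1) :=
    unif (p + 1) ≫ pair (𝟙 _) (matBox Γ ≫ hadamard (q + 1)) with hg
  set d : R (p + 1) ⊗ R (q + 1) ⟶ (R 1 ⊗ R 1) ⊗ (R p ⊗ R q) :=
    ((splitFirst p).hom ⊗ₘ (splitFirst q).hom) ≫ tensorμ _ _ _ _ with hd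
  have h1 : cls (bipartiteGraphState (q + 1) (p + 1) Γ) = s * g.val := by
    have hh : IsHom (cls (had (q + 1))) [q + 1] [q + 1] := .of_cls (f := had (q + 1)) q.succ_pos
    have e : cls (mat (q + 1) (p + 1) Γ) ⊚ cls (had (q + 1)) ⊚ sp .green (q + 1) 1 1 =
        cls (mat (q + 1) (p + 1) Γ) ⊚ cls (had (q + 1)) := by
      rw [sp_one_one q.succ_pos, DClass.comp_assoc, hh.comp_one]
    have e' : g.val = sp .green (p + 1) 0 2 ⊚
        (one [p + 1] * (cls (mat (q + 1) (p + 1) Γ) ⊚ cls (had (q + 1)))) := by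
      rw [hg, pair, ← Category.assoc, val_comp, unif_comp_comul]
      rfl
    rw [e', ← e, ← cls_wire]
    rfl
  have h2 : cls (firstQubits p q) = d.val := by
    rw [hd, val_comp, val_tensorHom, val_tensorμ, one_regs_R q,
      show braid (R p).regs (R 1).regs = cls (restSwap p) from (cls_restSwap p).symm]
    change _ = _ ⊚ (one [1] * _ * _)
    rw [← cls_wire]
    rfl
  have hS : IsHom s [] [] := isHom_tribone p
  rw [cls_comp, cls_comp, h1, h2, ← hx, ← scalar_mul_comp hS g.isHom d.isHom,
    ← scalar_mul_comp hS (g.isHom.comp d.isHom) x.isHom]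
  simp only [graphState, val_comp, hg, hd, DClass.comp_assoc]

/-- Pivoting for graph-state diagrams whose biadjacency matrices are related as those of a graph
and its pivot. -/
theorem provable_pivot {p q : ℕ} {Γ Γ' : Matrix (Fin (q + 1)) (Fin (p + 1)) (ZMod 2)}
    (h00 : Γ 0 0 = 1) (h00' : Γ' 0 0 = 1) (h0 : ∀ j : Fin p, Γ' 0 j.succ = Γ 0 j.succ)
    (h1 : ∀ i : Fin q, Γ' i.succ 0 = Γ i.succ 0)
    (h2 : ∀ (i : Fin q) (j : Fin p),
      Γ' i.succ j.succ = Γ i.succ j.succ + Γ i.succ 0 * Γ 0 j.succ) :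
    Provable
      (bipartiteGraphState (q + 1) (p + 1) Γ ⨟ firstQubits p q ⨟ (had 1 ⊠ had 1 ⊠ reg p ⊠ reg q))
      (bipartiteGraphState (q + 1) (p + 1) Γ' ⨟ firstQubits p q ⨟
        (swap 1 1 ⊠ reg p ⊠ reg q)) := by
  have x1 : Mor.val ((hadamard 1 ⊗ₘ hadamard 1) ⊗ₘ 𝟙 (R p ⊗ R q)) =
      cls (had 1 ⊠ had 1 ⊠ reg p ⊠ reg q) := by
    rw [val_tensorHom, val_id, regs_tensor, one_append, one_regs_R, one_regs_R, ← mul_assoc]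
    rfl
  have x2 : Mor.val ((β_ (R 1) (R 1)).hom ▷ (R p ⊗ R q)) = cls (swap 1 1 ⊠ reg p ⊠ reg q) := by
    rw [val_whiskerRight, regs_tensor, one_append, one_regs_R, one_regs_R, ← mul_assoc,
      val_braiding]
    change braid [1] [1] * _ * _ = _
    rw [braid_singleton_left one_pos (by simp), past_singleton one_pos one_pos]
    rfl
  have e1 := cls_bipartiteGraphState Γ _ x1
  refine provable_of_cls_eq (wellTyped_of_isHom_cls (e1 ▸ (isHom_tribone p).mul (Mor.isHom _))) ?_
  rw [e1, cls_bipartiteGraphState Γ' _ x2, graphState_pivot h00 h00' h0 h1 h2]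

/-! ### The biadjacency matrix of a pivoted graph -/

section

variable {V : Type*} {G : SimpleGraph V} {u v : V} {p q : ℕ}
  {e : Fin (1 + q) ⊕ Fin (1 + p) ≃ V}

theorem biadjacency_apply (H : SimpleGraph V) (e : Fin (1 + q) ⊕ Fin (1 + p) ≃ V) (i j) :
    biadjacency H e i j = open Classical in if H.Adj (e (.inl i)) (e (.inr j)) then 1 else 0 := rfl

theorem eq_vstack_hstack (Γ : Matrix (Fin (1 + q)) (Fin (1 + p)) (ZMod 2)) (h : Γ 0 0 = 1) :
    Γ = vstack (hstack 1 (Matrix.of fun _ j => Γ 0 (Fin.natAdd 1 j)))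
      (hstack (Matrix.of fun i _ => Γ (Fin.natAdd 1 i) 0)
        (Matrix.of fun i j => Γ (Fin.natAdd 1 i) (Fin.natAdd 1 j))) := by
  ext i j
  refine Fin.addCases (fun i => ?_) (fun i => ?_) i <;>
    refine Fin.addCases (fun j => ?_) (fun j => ?_) j
  · rw [Subsingleton.elim i 0, Subsingleton.elim j 0]
    simp [vstack, hstack]
    exact h
  · rw [Subsingleton.elim i 0]
    simp [vstack, hstack]
    rfl
  · rw [Subsingleton.elim j 0]
    simp [vstack, hstack]
    rfl
  · simp [vstack, hstack]

theorem not_adj_rows (hG : G.IsBipartiteWith (Set.range (e ∘ Sum.inl)) (Set.range (e ∘ Sum.inr)))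
    (i i' : Fin (1 + q)) : ¬ G.Adj (e (.inl i)) (e (.inl i')) := by
  intro h
  obtain h | h := hG.mem_of_adj h
  · exact Set.disjoint_left.1 hG.disjoint ⟨i', rfl⟩ h.2
  · exact Set.disjoint_left.1 hG.disjoint ⟨i, rfl⟩ h.1

variable [DecidableEq V]

/-- Only the block of the remaining rows and columns changes under pivoting, and by the product of
the column of `v` and the row of `u`. The other alternative in the definition of pivoting, a row
adjacent to `u` and a column adjacent to `v`, does not occur in a bipartite graph. -/
theorem biadjacency_pivot
    (hG : G.IsBipartiteWith (Set.range (e ∘ Sum.inl)) (Set.range (e ∘ Sum.inr)))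
    (hu : e (Sum.inl 0) = u) (hv : e (Sum.inr 0) = v) (huv : G.Adj u v) :
    biadjacency (pivot G u v) (e.trans (Equiv.swap u v)) 0 0 = 1 ∧
    (∀ j : Fin p, biadjacency (pivot G u v) (e.trans (Equiv.swap u v)) 0 (Fin.natAdd 1 j) =
      biadjacency G e 0 (Fin.natAdd 1 j)) ∧
    (∀ i : Fin q, biadjacency (pivot G u v) (e.trans (Equiv.swap u v)) (Fin.natAdd 1 i) 0 =
      biadjacency G e (Fin.natAdd 1 i) 0) ∧
    ∀ (i : Fin q) (j : Fin p),
      biadjacency (pivot G u v) (e.trans (Equiv.swap u v)) (Fin.natAdd 1 i) (Fin.natAdd 1 j) =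
        biadjacency G e (Fin.natAdd 1 i) (Fin.natAdd 1 j) +
          biadjacency G e (Fin.natAdd 1 i) 0 * biadjacency G e 0 (Fin.natAdd 1 j) := by
  have hi (i : Fin q) : e (.inl (Fin.natAdd 1 i)) ≠ u ∧ e (.inl (Fin.natAdd 1 i)) ≠ v := by
    rw [← hu, ← hv, e.injective.ne_iff, e.injective.ne_iff]
    refine ⟨fun h => ?_, by simp⟩
    simpa using congrArg Fin.val (Sum.inl.inj h)
  have hj (j : Fin p) : e (.inr (Fin.natAdd 1 j)) ≠ u ∧ e (.inr (Fin.natAdd 1 j)) ≠ v := by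
    rw [← hu, ← hv, e.injective.ne_iff, e.injective.ne_iff]
    refine ⟨by simp, fun h => ?_⟩
    simpa using congrArg Fin.val (Sum.inr.inj h)
  have hui (i : Fin q) : ¬ G.Adj u (e (.inl (Fin.natAdd 1 i))) := by
    rw [← hu]
    exact not_adj_rows hG _ _
  have si (i : Fin q) := Equiv.swap_apply_of_ne_of_ne (hi i).1 (hi i).2
  have sj (j : Fin p) := Equiv.swap_apply_of_ne_of_ne (hj j).1 (hj j).2
  have eu : e.trans (Equiv.swap u v) (.inl 0) = v := by simp [hu]
  have ev : e.trans (Equiv.swap u v) (.inr 0) = u := by simp [hv]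
  have ei (i : Fin q) : e.trans (Equiv.swap u v) (.inl (Fin.natAdd 1 i)) = _ := si i
  have ej (j : Fin p) : e.trans (Equiv.swap u v) (.inr (Fin.natAdd 1 j)) = _ := sj j
  refine ⟨?_, fun j => ?_, fun i => ?_, fun i j => ?_⟩
  · rw [biadjacency_apply, eu, ev]
    exact if_pos (by simp [pivot, Xor, huv])
  · rw [biadjacency_apply, biadjacency_apply, eu, ej, hu]
    congr 1
    simp [pivot, Xor, sj]
  · rw [biadjacency_apply, biadjacency_apply, ev, ei, hv]
    congr 1
    simp [pivot, Xor, si]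
  · have key : (pivot G u v).Adj (e (.inl (Fin.natAdd 1 i))) (e (.inr (Fin.natAdd 1 j))) ↔
        Xor (G.Adj (e (.inl (Fin.natAdd 1 i))) (e (.inr (Fin.natAdd 1 j))))
          (G.Adj (e (.inl (Fin.natAdd 1 i))) v ∧ G.Adj u (e (.inr (Fin.natAdd 1 j)))) := by
      simp [pivot, si, sj, hi, hj, hui, G.adj_comm _ v]
    rw [biadjacency_apply, biadjacency_apply, biadjacency_apply, biadjacency_apply, ei, ej, hu, hv,
      propext key]
    by_cases h1 : G.Adj (e (.inl (Fin.natAdd 1 i))) (e (.inr (Fin.natAdd 1 j))) <;>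
    by_cases h2 : G.Adj (e (.inl (Fin.natAdd 1 i))) v <;>
    by_cases h3 : G.Adj u (e (.inr (Fin.natAdd 1 j))) <;>
    simp [h1, h2, h3, Xor, CharTwo.add_self_eq_zero]

end

end SZX

theorem mainTheorem6 {V : Type*} [DecidableEq V] (G : SimpleGraph V) (u v : V) (huv : G.Adj u v)
    (p q : ℕ) (e : Fin (1 + q) ⊕ Fin (1 + p) ≃ V)
    (hG : G.IsBipartiteWith (Set.range (e ∘ Sum.inl)) (Set.range (e ∘ Sum.inr)))
    (hu : e (Sum.inl 0) = u) (hv : e (Sum.inr 0) = v) :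
    (∃ (A : Matrix (Fin 1) (Fin p) (ZMod 2)) (B : Matrix (Fin q) (Fin 1) (ZMod 2))
        (C : Matrix (Fin q) (Fin p) (ZMod 2)),
      SZX.biadjacency G e = SZX.vstack (SZX.hstack 1 A) (SZX.hstack B C) ∧
      SZX.biadjacency (SZX.pivot G u v) (e.trans (Equiv.swap u v)) =
        SZX.vstack (SZX.hstack 1 A) (SZX.hstack B (C + B * A))) ∧
    SZX.Provable
      (SZX.bipartiteGraphState (1 + q) (1 + p) (SZX.biadjacency G e) ⨟
        SZX.firstQubits p q ⨟
        (SZX.Diag.had 1 ⊠ SZX.Diag.had 1 ⊠ SZX.Diag.reg p ⊠ SZX.Diag.reg q))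
      (SZX.bipartiteGraphState (1 + q) (1 + p)
          (SZX.biadjacency (SZX.pivot G u v) (e.trans (Equiv.swap u v))) ⨟
        SZX.firstQubits p q ⨟
        (SZX.Diag.swap 1 1 ⊠ SZX.Diag.reg p ⊠ SZX.Diag.reg q)) := by
  have h00 : SZX.biadjacency G e 0 0 = 1 := by
    rw [SZX.biadjacency_apply, hu, hv, if_pos huv]
  obtain ⟨h00', h0, h1, h2⟩ := SZX.biadjacency_pivot hG hu hv huv
  constructor
  · refine ⟨_, _, _, SZX.eq_vstack_hstack _ h00, ?_⟩
    rw [SZX.eq_vstack_hstack _ h00']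
    congr 2
    · ext i j
      exact h0 j
    · ext i j
      exact h1 i
    · ext i j
      simpa [Matrix.mul_apply] using h2 i j
  · rw [← SZX.bipartiteGraphState_cast (Nat.add_comm q 1) (Nat.add_comm p 1),
      ← SZX.bipartiteGraphState_cast (Nat.add_comm q 1) (Nat.add_comm p 1)]
    have hs {n : ℕ} (i : Fin n) : Fin.cast (Nat.add_comm n 1) i.succ = Fin.natAdd 1 i :=
      Fin.ext (Nat.add_comm _ _)
    refine SZX.provable_pivot h00 h00' (fun j => ?_) (fun i => ?_) (fun i j => ?_)
    · simp only [Matrix.submatrix_apply, hs]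
      exact h0 j
    · simp only [Matrix.submatrix_apply, hs]
      exact h1 i
    · simp only [Matrix.submatrix_apply, hs]
      exact h2 i j
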